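/- Let $N$ be an odd-dimensional smooth manifold. An almost contact metric structure $(g,\xi,\eta,\varphi)$ on $N$ consists of a Riemannian metric $g$, a unit vector field $\xi$, its dual $1$-form $\eta=g(\xi,\cdot)$ and an endomorphism $\varphi$ of $TN$ with $\varphi(\xi)=0$, $\varphi^2=-1+\eta\otimes\xi$ and $g(\varphi X,\varphi Y)=g(X,Y)-\eta(X)\eta(Y)$. It is *normal* if $$[\varphi X,\varphi Y]+\varphi^2[X,Y]-\varphi[\varphi X,Y]-\varphi[X,\varphi Y]+d\eta(X,Y)\,\xi=0$$ for all vector fields $X,Y$, where $d\eta(X,Y)=X\eta(Y)-Y\eta(X)-\eta([X,Y])$. It is *ST* (Sasaki with torsion) if it is normal and $\xi$ is a Killing field. Put $F=g(\varphi\cdot,\cdot)$ and $d^\varphi F=dF(\varphi\cdot,\varphi\cdot,\varphi\cdot)$. A normal almost contact metric structure is *Sasaki* if $d\eta=2F$. An almost Hermitian manifold $(M,g,J)$ is *KT* with torsion $3$-form $c$ if $J$ is integrable (its Nijenhuis tensor vanishes) and there is a connection $\nabla$ on $TM$ with $\nabla g=0=\nabla J$ and $g(\nabla_XY-\nabla_YX-[X,Y],Z)=c(X,Y,Z)$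 for all $X,Y,Z$. It is *SKT* if it is KT with a torsion $3$-form $c$ such that $dc=0$. **Proposition.** Let $(N,g,\xi,\eta,\varphi)$ be an ST manifold. On the Riemannian cone $\mathcal C(N)=\mathbb R_+\times N$, $g_{\mathcal C}=dr^2+r^2g$, let $J_{\mathcal C}$ be the almost complex structure given by $J_{\mathcal C}\,\partial_r=\xi/r$, $J_{\mathcal C}\,\xi=-r\,\partial_r$ and $J_{\mathcal C}=\varphi$ on $\ker\eta\subset TN$. Then $g_{\mathcal C}(J_{\mathcal C}\cdot,\cdot)=\omega_{\mathcal C}$ with $\omega_{\mathcal C}=r\,dr\wedge\eta+r^2F$. Moreover: 1. $(\mathcal C(N),g_{\mathcal C},J_{\mathcal C})$ is KT with torsion $3$-form $r^2\bigl(\eta\wedge(d\eta-2F)+d^\varphi F\bigr)$; 2. $(\mathcal C(N),g_{\mathcal C},J_{\mathcal C})$ is SKT if and only if $(N,g,\xi,\eta,\varphi)$ is Sasaki. -/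

import Mathlib

open scoped Manifold ContDiff Bundle Topology
open Set Bundle Module

noncomputable section

namespace TorsionGeometry

section Forms

variable {V : Type*} [AddCommGroup V] [Module ℝ V] [TopologicalSpace V]

/-- `α ∧ β` for a `1`-form `α` and a `k`-form `β`, without normalizing factor:
`(α ∧ β)(v₀, …, v_k) = ∑ i, (-1) ^ i α(v_i) β(v₀, …, v_k without v_i)`. -/
def wedge {k : ℕ} (α : V →L[ℝ] ℝ) (β : V [⋀^Fin k]→L[ℝ] ℝ) : V [⋀^Fin (k + 1)]→L[ℝ] ℝ where
  toMultilinearMap := (AlternatingMap.alternatizeUncurryFin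
    ((α : V →ₗ[ℝ] ℝ).smulRight β.toAlternatingMap)).toMultilinearMap
  map_eq_zero_of_eq' := (AlternatingMap.alternatizeUncurryFin
    ((α : V →ₗ[ℝ] ℝ).smulRight β.toAlternatingMap)).map_eq_zero_of_eq'
  cont := by
    have h : ∀ v : Fin (k + 1) → V, AlternatingMap.alternatizeUncurryFin
        ((α : V →ₗ[ℝ] ℝ).smulRight β.toAlternatingMap) v =
        ∑ i : Fin (k + 1), (-1 : ℤ) ^ (i : ℕ) • (α (v i) * β (i.removeNth v)) := by
      intro v
      simp [AlternatingMap.alternatizeUncurryFin_apply]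
    refine Continuous.congr (f := fun v : Fin (k + 1) → V =>
      ∑ i : Fin (k + 1), (-1 : ℤ) ^ (i : ℕ) • (α (v i) * β (i.removeNth v))) ?_
      (fun v => (h v).symm)
    refine continuous_finsetSum _ fun i _ => Continuous.zsmul ?_ _
    refine (α.continuous.comp (continuous_apply i)).mul (β.cont.comp ?_)
    exact continuous_pi fun j => continuous_apply _

theorem wedge_apply {k : ℕ} (α : V →L[ℝ] ℝ) (β : V [⋀^Fin k]→L[ℝ] ℝ) (v : Fin (k + 1) → V) :
    wedge α β v = ∑ i : Fin (k + 1), (-1 : ℝ) ^ (i : ℕ) * (α (v i) * β (i.removeNth v)) := by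
  have : wedge α β v = AlternatingMap.alternatizeUncurryFin
    ((α : V →ₗ[ℝ] ℝ).smulRight β.toAlternatingMap) v := rfl
  rw [this, AlternatingMap.alternatizeUncurryFin_apply]
  simp

/-- A continuous linear functional as a `1`-form. -/
def oneForm (α : V →L[ℝ] ℝ) : V [⋀^Fin 1]→L[ℝ] ℝ :=
  ContinuousAlternatingMap.ofSubsingleton ℝ V ℝ 0 α

/-- The `2`-form `(X, Y) ↦ b X Y` of a bilinear form `b` with `b X X = 0`. -/
def twoForm (b : V →L[ℝ] V →L[ℝ] ℝ) (hc : Continuous fun p : V × V => b p.1 p.2)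
    (hb : ∀ v, b v v = 0) : V [⋀^Fin 2]→L[ℝ] ℝ where
  toFun v := b (v 0) (v 1)
  map_update_add' := by
    intro _ v i x y
    fin_cases i <;> simp [Function.update]
  map_update_smul' := by
    intro _ v i c x
    fin_cases i <;> simp [Function.update]
  map_eq_zero_of_eq' := by
    intro v i j h hij
    fin_cases i <;> fin_cases j <;> simp_all
  cont := by
    have h : Continuous fun v : Fin 2 → V => (v 0, v 1) :=
      (continuous_apply 0).prodMk (continuous_apply 1)
    exact hc.comp h

end Forms

section Manifold

variable {E : Type*} [NormedAddCommGroup E] [NormedSpace ℝ E]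
  {H : Type*} [TopologicalSpace H] (I : ModelWithCorners ℝ E H)
  {M : Type*} [TopologicalSpace M] [ChartedSpace H M]

/-- Differential `k`-forms on `M` (smoothness is not part of the type). -/
abbrev DiffForm (M : Type*) [TopologicalSpace M] [ChartedSpace H M] (k : ℕ) :=
  Π x : M, TangentSpace I x [⋀^Fin k]→L[ℝ] ℝ

variable {I}

/-- The exterior derivative of a form on a manifold, computed at `x` by pulling the form back to
the model space along the inverse of the preferred chart at `x`. -/
def extD {k : ℕ} (α : DiffForm I M k) : DiffForm I M (k + 1) := fun x =>
  (extDerivWithin (fun y : E =>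
      (α ((extChartAt I x).symm y)).compContinuousLinearMap
        (mfderivWithin 𝓘(ℝ, E) I (extChartAt I x).symm (range I) y))
    (range I) (extChartAt I x x)).compContinuousLinearMap (mfderiv I 𝓘(ℝ, E) (extChartAt I x) x)

variable (I) in
/-- Smooth Riemannian metrics on `M`. -/
abbrev RiemMetric (M : Type*) [TopologicalSpace M] [ChartedSpace H M] [IsManifold I ∞ M] :=
  ContMDiffRiemannianMetric I ∞ E (fun x : M => TangentSpace I x)

theorem continuous_bilin {x : M} (b : TangentSpace I x →L[ℝ] TangentSpace I x →L[ℝ] ℝ) :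
    Continuous fun p : TangentSpace I x × TangentSpace I x => b p.1 p.2 := by
  let b' : E →L[ℝ] E →L[ℝ] ℝ := b
  exact (b'.continuous.comp continuous_fst).clm_apply continuous_snd


variable [IsManifold I ∞ M]

variable (I M) in
/-- An almost contact metric structure `(g, ξ, η, φ)` with `η = g(ξ, ·)`. -/
structure AlmostContactMetric where
  /-- the Riemannian metric -/
  g : RiemMetric I M
  /-- the Reeb vector field -/
  ξ : Π x : M, TangentSpace I x
  /-- the bundle endomorphism -/
  φ : Π x : M, TangentSpace I x →L[ℝ] TangentSpace I x
  smooth_ξ : ContMDiff I I.tangent ∞ (fun x => (⟨x, ξ x⟩ : TangentBundle I M))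
  smooth_φ : ContMDiff I (I.prod 𝓘(ℝ, E →L[ℝ] E)) ∞
    (fun x => TotalSpace.mk' (E →L[ℝ] E) (E := fun y : M => TangentSpace I y →L[ℝ] TangentSpace I y)
      x (φ x))
  unit_ξ : ∀ x, g.inner x (ξ x) (ξ x) = 1
  φ_ξ : ∀ x, φ x (ξ x) = 0
  φ_φ : ∀ x X, φ x (φ x X) = -X + g.inner x (ξ x) X • ξ x
  compat : ∀ x X Y, g.inner x (φ x X) (φ x Y)
    = g.inner x X Y - g.inner x (ξ x) X * g.inner x (ξ x) Y

variable (I M) in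
/-- An almost Hermitian structure `(g, J)`. -/
structure AlmostHermitian where
  /-- the Riemannian metric -/
  g : RiemMetric I M
  /-- the almost complex structure -/
  J : Π x : M, TangentSpace I x →L[ℝ] TangentSpace I x
  smooth_J : ContMDiff I (I.prod 𝓘(ℝ, E →L[ℝ] E)) ∞
    (fun x => TotalSpace.mk' (E →L[ℝ] E) (E := fun y : M => TangentSpace I y →L[ℝ] TangentSpace I y)
      x (J x))
  J_J : ∀ x X, J x (J x X) = -X
  compat : ∀ x X Y, g.inner x (J x X) (J x Y) = g.inner x X Y

namespace AlmostContactMetric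

variable (S : AlmostContactMetric I M)

/-- The dual `1`-form `η = g(ξ, ·)`. -/
def η (x : M) : TangentSpace I x →L[ℝ] ℝ := S.g.inner x (S.ξ x)

theorem η_ξ (x : M) : S.η x (S.ξ x) = 1 := S.unit_ξ x

theorem η_φ (x : M) (X : TangentSpace I x) : S.η x (S.φ x X) = 0 := by
  have h1 := S.φ_φ x (S.φ x X)
  rw [S.φ_φ x X, map_add, map_neg, map_smul, S.φ_ξ, smul_zero, add_zero, left_eq_add] at h1
  have h2 := congrArg (S.η x) h1
  rw [map_smul, S.η_ξ, map_zero, smul_eq_mul, mul_one] at h2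
  exact h2

theorem inner_φ_self (x : M) (X : TangentSpace I x) : S.g.inner x (S.φ x X) X = 0 := by
  have h1 := S.compat x (S.φ x X) X
  have h2 : S.g.inner x (S.ξ x) (S.φ x X) = 0 := S.η_φ x X
  have h3 : S.g.inner x (S.ξ x) (S.φ x X) = S.g.inner x (S.φ x X) (S.ξ x) := S.g.symm ..
  have h4 := S.g.symm x X (S.φ x X)
  rw [S.φ_φ] at h1
  simp only [map_add, map_neg, map_smul, add_apply, neg_apply, smul_apply, h2,
    zero_mul, sub_zero, smul_eq_mul, mul_zero, add_zero] at h1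
  linarith

/-- The fundamental `2`-form `F = g(φ ·, ·)`. -/
def F : DiffForm I M 2 := fun x =>
  twoForm ((S.g.inner x).comp (S.φ x)) (continuous_bilin _) (S.inner_φ_self x)

/-- The exterior derivative `dη`. -/
def dη : DiffForm I M 2 := extD fun x => oneForm (S.η x)

/-- `d^φ F = dF(φ ·, φ ·, φ ·)`. -/
def dφF : DiffForm I M 3 := fun x => (extD S.F x).compContinuousLinearMap (S.φ x)

/-- Normality (the fields `X`, `Y` only have to be differentiable at the point `x`): the Sasaki-Hatakeyama tensor
`[φX, φY] + φ²[X, Y] - φ[φX, Y] - φ[X, φY] + dη(X, Y) ξ` vanishes. -/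
def IsNormal : Prop :=
  ∀ (x : M) (X Y : Π y : M, TangentSpace I y),
    MDifferentiableAt I I.tangent (fun y => (⟨y, X y⟩ : TangentBundle I M)) x →
    MDifferentiableAt I I.tangent (fun y => (⟨y, Y y⟩ : TangentBundle I M)) x →
    VectorField.mlieBracket I (fun y => S.φ y (X y)) (fun y => S.φ y (Y y)) x
      + S.φ x (S.φ x (VectorField.mlieBracket I X Y x))
      - S.φ x (VectorField.mlieBracket I (fun y => S.φ y (X y)) Y x)
      - S.φ x (VectorField.mlieBracket I X (fun y => S.φ y (Y y)) x)
      + S.dη x ![X x, Y x] • S.ξ x = 0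

/-- `ξ` is a Killing vector field, `L_ξ g = 0`. -/
def IsKilling : Prop :=
  ∀ (x : M) (X Y : Π y : M, TangentSpace I y),
    MDifferentiableAt I I.tangent (fun y => (⟨y, X y⟩ : TangentBundle I M)) x →
    MDifferentiableAt I I.tangent (fun y => (⟨y, Y y⟩ : TangentBundle I M)) x →
    mvfderiv I (fun y => S.g.inner y (X y) (Y y)) x (S.ξ x)
      = S.g.inner x (VectorField.mlieBracket I S.ξ X x) (Y x)
        + S.g.inner x (X x) (VectorField.mlieBracket I S.ξ Y x)

/-- Sasaki with torsion: a normal almost contact metric structure with Killing Reeb field. -/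
def IsST : Prop := S.IsNormal ∧ S.IsKilling

/-- Sasaki: a normal almost contact metric structure with `dη = 2F`. -/
def IsSasaki : Prop := S.IsNormal ∧ ∀ x, S.dη x = (2 : ℝ) • S.F x

end AlmostContactMetric

namespace AlmostHermitian

variable (A : AlmostHermitian I M)

theorem inner_J_self (x : M) (X : TangentSpace I x) : A.g.inner x (A.J x X) X = 0 := by
  have h1 := A.compat x (A.J x X) X
  have h2 := A.g.symm x X (A.J x X)
  rw [A.J_J, map_neg, neg_apply] at h1
  linarith

/-- The fundamental `2`-form `g(J ·, ·)`. -/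
def fundForm : DiffForm I M 2 := fun x =>
  twoForm ((A.g.inner x).comp (A.J x)) (continuous_bilin _) (A.inner_J_self x)

/-- Integrability of `J`: the Nijenhuis tensor vanishes. -/
def IsIntegrable : Prop :=
  ∀ (x : M) (X Y : Π y : M, TangentSpace I y),
    MDifferentiableAt I I.tangent (fun y => (⟨y, X y⟩ : TangentBundle I M)) x →
    MDifferentiableAt I I.tangent (fun y => (⟨y, Y y⟩ : TangentBundle I M)) x →
    VectorField.mlieBracket I (fun y => A.J y (X y)) (fun y => A.J y (Y y)) x
      - VectorField.mlieBracket I X Y x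
      - A.J x (VectorField.mlieBracket I (fun y => A.J y (X y)) Y x)
      - A.J x (VectorField.mlieBracket I X (fun y => A.J y (Y y)) x) = 0

/-- `D` is a smooth connection with `Dg = 0`, `DJ = 0` whose torsion tensor `T` is the `3`-form
`c`, that is, `g(T(X, Y), Z) = c(X, Y, Z)` where `T(X, Y) = D_X Y - D_Y X - [X, Y]`. As `Dg = 0`,
this is the same as `g(D_X Y - D^LC_X Y, Z) = c(X, Y, Z) / 2`. In Lean `D Y x X` is `D_X Y` at `x`. -/
structure IsKTConnection [FiniteDimensional ℝ E]
    (D : CovariantDerivative I E (fun x : M => TangentSpace I x)) (c : DiffForm I M 3) : Prop where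
  smooth : CovariantDerivative.ContMDiffCovariantDerivative D ∞
  metric : ∀ (x : M) (Y Z : Π y : M, TangentSpace I y) (X : TangentSpace I x),
    MDifferentiableAt I I.tangent (fun y => (⟨y, Y y⟩ : TangentBundle I M)) x →
    MDifferentiableAt I I.tangent (fun y => (⟨y, Z y⟩ : TangentBundle I M)) x →
    mvfderiv I (fun y => A.g.inner y (Y y) (Z y)) x X
      = A.g.inner x (D Y x X) (Z x) + A.g.inner x (Y x) (D Z x X)
  parallel : ∀ (x : M) (Y : Π y : M, TangentSpace I y) (X : TangentSpace I x),
    MDifferentiableAt I I.tangent (fun y => (⟨y, Y y⟩ : TangentBundle I M)) x →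
    D (fun y => A.J y (Y y)) x X = A.J x (D Y x X)
  torsion : ∀ (x : M) (X Y Z : TangentSpace I x),
    A.g.inner x (D.torsion x X Y) Z = c x ![X, Y, Z]

variable [FiniteDimensional ℝ E]

/-- `(g, J)` is a Kähler with torsion structure with torsion `3`-form `c`: it is Hermitian and
carries a Hermitian connection with skew-symmetric torsion `c`. -/
def IsKTWithTorsion (c : DiffForm I M 3) : Prop :=
  A.IsIntegrable ∧ ∃ D : CovariantDerivative I E (fun x : M => TangentSpace I x),
    A.IsKTConnection D c

/-- Strong Kähler with torsion: the torsion `3`-form is closed. -/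
def IsSKT : Prop := ∃ c : DiffForm I M 3, A.IsKTWithTorsion c ∧ ∀ x, extD c x = 0

end AlmostHermitian

end Manifold

section Cone

/-- The positive half-line as an open submanifold of `ℝ`. -/
def PosReal : TopologicalSpace.Opens ℝ := ⟨Ioi 0, isOpen_Ioi⟩

/-- The cone `ℝ₊ × N`, with its product manifold structure. -/
abbrev Cone (N : Type*) := PosReal × N

variable {E : Type*} [NormedAddCommGroup E] [NormedSpace ℝ E]
  {H : Type*} [TopologicalSpace H] {I : ModelWithCorners ℝ E H}
  {N : Type*} [TopologicalSpace N] [ChartedSpace H N]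

variable (I) in
/-- The radial `1`-form `dr`, the differential of the coordinate `r`. -/
def dr (x : Cone N) : TangentSpace (𝓘(ℝ, ℝ).prod I) x →L[ℝ] ℝ :=
  mvfderiv (𝓘(ℝ, ℝ).prod I) (fun y : Cone N => (y.1 : ℝ)) x

variable (I) in
/-- The differential of the projection of the cone onto its base. -/
def dπ (x : Cone N) : TangentSpace (𝓘(ℝ, ℝ).prod I) x →L[ℝ] TangentSpace I x.2 :=
  mfderiv (𝓘(ℝ, ℝ).prod I) I (fun y : Cone N => y.2) x

variable (I) in
/-- The tangent vector `a ∂/∂r + v` at a point of the cone, under the identification of the tangent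
space of a product with the product of the tangent spaces. -/
def coneVec (x : Cone N) : (ℝ × TangentSpace I x.2) →L[ℝ] TangentSpace (𝓘(ℝ, ℝ).prod I) x :=
  ContinuousLinearMap.id ℝ (ℝ × TangentSpace I x.2)

theorem hasMFDerivAt_val (r : PosReal) :
    HasMFDerivAt 𝓘(ℝ, ℝ) 𝓘(ℝ, ℝ) (fun s : PosReal => (s : ℝ)) r
      (ContinuousLinearMap.id ℝ (TangentSpace 𝓘(ℝ, ℝ) r)) := by
  refine ⟨continuous_subtype_val.continuousAt, ?_⟩
  have h : writtenInExtChartAt 𝓘(ℝ, ℝ) 𝓘(ℝ, ℝ) r (fun s : PosReal => (s : ℝ))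
      =ᶠ[𝓝 (extChartAt 𝓘(ℝ, ℝ) r r)] id := by
    have ht : (extChartAt 𝓘(ℝ, ℝ) r).target ∈ 𝓝 (extChartAt 𝓘(ℝ, ℝ) r r) :=
      extChartAt_target_mem_nhds r
    filter_upwards [ht] with y hy
    exact (extChartAt 𝓘(ℝ, ℝ) r).right_inv hy
  simp only [modelWithCornersSelf_coe, range_id]
  exact ((hasFDerivAt_id _).congr_of_eventuallyEq h).hasFDerivWithinAt

theorem dr_coneVec (x : Cone N) (a : ℝ) (v : TangentSpace I x.2) :
    dr I x (coneVec I x (a, v)) = a := by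
  have h : HasMFDerivAt (𝓘(ℝ, ℝ).prod I) 𝓘(ℝ, ℝ) (fun y : Cone N => (y.1 : ℝ)) x _ :=
    HasMFDerivAt.comp x (hasMFDerivAt_val x.1) (hasMFDerivAt_fst (x := x))
  simp only [dr, mvfderiv, h.mfderiv]
  rfl

theorem dπ_coneVec (x : Cone N) (a : ℝ) (v : TangentSpace I x.2) :
    dπ I x (coneVec I x (a, v)) = v := by
  simp only [dπ]
  erw [mfderiv_snd]
  rfl

theorem coneVec_dr_dπ (x : Cone N) (X : TangentSpace (𝓘(ℝ, ℝ).prod I) x) :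
    coneVec I x (dr I x X, dπ I x X) = X := by
  let Y : ℝ × TangentSpace I x.2 := X
  have h1 : dr I x X = Y.1 := dr_coneVec x Y.1 Y.2
  have h2 : dπ I x X = Y.2 := dπ_coneVec x Y.1 Y.2
  rw [h1, h2]
  rfl

variable (I) in
/-- The bilinear form `dr ⊗ dr + r² b` at a point `(r, p)` of the cone, for `b` on `T_p N`. -/
def coneInner (x : Cone N) (b : TangentSpace I x.2 →L[ℝ] TangentSpace I x.2 →L[ℝ] ℝ) :
    TangentSpace (𝓘(ℝ, ℝ).prod I) x →L[ℝ] TangentSpace (𝓘(ℝ, ℝ).prod I) x →L[ℝ] ℝ :=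
  (dr I x).smulRight (dr I x) +
    (x.1 : ℝ) ^ 2 • (ContinuousLinearMap.precomp ℝ (dπ I x)).comp (b.comp (dπ I x))

theorem coneInner_apply (x : Cone N) (b : TangentSpace I x.2 →L[ℝ] TangentSpace I x.2 →L[ℝ] ℝ)
    (X Y : TangentSpace (𝓘(ℝ, ℝ).prod I) x) :
    coneInner I x b X Y = dr I x X * dr I x Y + (x.1 : ℝ) ^ 2 * b (dπ I x X) (dπ I x Y) := rfl

section Smooth

theorem contMDiffAt_hom {B : Type*} [TopologicalSpace B] [ChartedSpace H B]
    {F₁ F₂ : Type*} [NormedAddCommGroup F₁] [NormedSpace ℝ F₁] [FiniteDimensional ℝ F₁]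
    [NormedAddCommGroup F₂] [NormedSpace ℝ F₂] {V₁ V₂ : B → Type*}
    [TopologicalSpace (TotalSpace F₁ V₁)] [∀ x, AddCommGroup (V₁ x)] [∀ x, Module ℝ (V₁ x)]
    [∀ x, TopologicalSpace (V₁ x)] [FiberBundle F₁ V₁] [VectorBundle ℝ F₁ V₁]
    [ContMDiffVectorBundle ∞ F₁ V₁ I]
    [TopologicalSpace (TotalSpace F₂ V₂)] [∀ x, AddCommGroup (V₂ x)] [∀ x, Module ℝ (V₂ x)]
    [∀ x, TopologicalSpace (V₂ x)] [FiberBundle F₂ V₂] [VectorBundle ℝ F₂ V₂]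
    [∀ x, IsTopologicalAddGroup (V₂ x)] [∀ x, ContinuousSMul ℝ (V₂ x)]
    (A : Π x, V₁ x →L[ℝ] V₂ x) (x₀ : B)
    (h : ∀ X : Π x, V₁ x, ContMDiffAt I (I.prod 𝓘(ℝ, F₁)) ∞ (fun x => TotalSpace.mk' F₁ x (X x)) x₀ →
      ContMDiffAt I (I.prod 𝓘(ℝ, F₂)) ∞ (fun x => TotalSpace.mk' F₂ x (A x (X x))) x₀) :
    ContMDiffAt I (I.prod 𝓘(ℝ, F₁ →L[ℝ] F₂)) ∞
      (fun x => TotalSpace.mk' (F₁ →L[ℝ] F₂) (E := fun y => V₁ y →L[ℝ] V₂ y) x (A x)) x₀ := by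
  rw [contMDiffAt_hom_bundle]
  refine ⟨contMDiffAt_id, ?_⟩
  set b := Module.finBasis ℝ F₁
  have key : ∀ v : F₁, ContMDiffAt I 𝓘(ℝ, F₂) ∞
      (fun x => ContinuousLinearMap.inCoordinates F₁ V₁ F₂ V₂ x₀ x x₀ x (A x) v) x₀ := by
    intro v
    have h0 : x₀ ∈ (trivializationAt F₁ V₁ x₀).baseSet := FiberBundle.mem_baseSet_trivializationAt' x₀
    have h0' : x₀ ∈ (trivializationAt F₂ V₂ x₀).baseSet := FiberBundle.mem_baseSet_trivializationAt' x₀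
    have h1 := h _ (FiberBundle.contMDiffAt_extend I F₁ ((trivializationAt F₁ V₁ x₀).symm x₀ v))
    rw [contMDiffAt_totalSpace] at h1
    refine h1.2.congr_of_eventuallyEq ?_
    filter_upwards [(trivializationAt F₁ V₁ x₀).open_baseSet.mem_nhds h0,
      (trivializationAt F₂ V₂ x₀).open_baseSet.mem_nhds h0'] with x hx hx'
    rw [ContinuousLinearMap.inCoordinates_eq hx hx']
    simp [FiberBundle.extend, h0]
  have h2 : (fun x => ContinuousLinearMap.inCoordinates F₁ V₁ F₂ V₂ x₀ x x₀ x (A x)) =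
      fun x => ∑ i, ((b.coord i).toContinuousLinearMap).smulRight
        (ContinuousLinearMap.inCoordinates F₁ V₁ F₂ V₂ x₀ x x₀ x (A x) (b i)) := by
    ext x v
    conv_lhs => rw [← b.sum_repr v, map_sum]
    simp
  simp only [TotalSpace.mk']
  rw [h2]
  refine contMDiffAt_finsetSum fun i _ => ?_
  exact ((ContinuousLinearMap.smulRightL ℝ F₁ F₂
    ((b.coord i).toContinuousLinearMap)).contMDiff.contMDiffAt).comp x₀ (key (b i))


variable [IsManifold I ∞ N]

theorem contMDiffAt_dr (x₀ : Cone N) (X : Π x : Cone N, TangentSpace (𝓘(ℝ, ℝ).prod I) x)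
    (hX : ContMDiffAt (𝓘(ℝ, ℝ).prod I) (𝓘(ℝ, ℝ).prod I).tangent ∞
      (fun x => (⟨x, X x⟩ : TangentBundle (𝓘(ℝ, ℝ).prod I) (Cone N))) x₀) :
    ContMDiffAt (𝓘(ℝ, ℝ).prod I) 𝓘(ℝ, ℝ) ∞ (fun x => dr I x (X x)) x₀ := by
  have h1 : ContMDiff (𝓘(ℝ, ℝ).prod I) 𝓘(ℝ, ℝ) ∞ (fun y : Cone N => (y.1 : ℝ)) :=
    contMDiff_subtype_val.comp contMDiff_fst
  have h2 := ((h1.contMDiff_tangentMap (m := ∞) le_rfl).contMDiffAt).comp x₀ hX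
  exact ((contMDiff_snd_tangentBundle_modelSpace ℝ 𝓘(ℝ, ℝ)).contMDiffAt).comp x₀ h2

theorem contMDiffAt_dπ (x₀ : Cone N) (X : Π x : Cone N, TangentSpace (𝓘(ℝ, ℝ).prod I) x)
    (hX : ContMDiffAt (𝓘(ℝ, ℝ).prod I) (𝓘(ℝ, ℝ).prod I).tangent ∞
      (fun x => (⟨x, X x⟩ : TangentBundle (𝓘(ℝ, ℝ).prod I) (Cone N))) x₀) :
    ContMDiffAt (𝓘(ℝ, ℝ).prod I) I.tangent ∞
      (fun x => (⟨x.2, dπ I x (X x)⟩ : TangentBundle I N)) x₀ := by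
  have h1 : ContMDiff (𝓘(ℝ, ℝ).prod I) I ∞ (fun y : Cone N => y.2) := contMDiff_snd
  exact ((h1.contMDiff_tangentMap (m := ∞) le_rfl).contMDiffAt).comp x₀ hX

theorem trivializationAt_posReal (r s : PosReal) (a : TangentSpace 𝓘(ℝ, ℝ) s) :
    (trivializationAt ℝ (TangentSpace 𝓘(ℝ, ℝ)) r (⟨s, a⟩ : TangentBundle 𝓘(ℝ, ℝ) PosReal)).2
      = a := by
  rw [TangentBundle.trivializationAt_apply]
  have hc : chartAt ℝ r = chartAt ℝ s := rfl
  have h := tangentCoordChange_self (I := 𝓘(ℝ, ℝ)) (x := s) (z := s) (v := a)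
    (mem_extChartAt_source s)
  rw [tangentCoordChange_def] at h
  rw [hc]
  exact h

theorem contMDiffAt_coneVec (x₀ : Cone N) (a : Cone N → ℝ)
    (v : Π x : Cone N, TangentSpace I x.2) (ha : ContMDiffAt (𝓘(ℝ, ℝ).prod I) 𝓘(ℝ, ℝ) ∞ a x₀)
    (hv : ContMDiffAt (𝓘(ℝ, ℝ).prod I) I.tangent ∞
      (fun x => (⟨x.2, v x⟩ : TangentBundle I N)) x₀) :
    ContMDiffAt (𝓘(ℝ, ℝ).prod I) (𝓘(ℝ, ℝ).prod I).tangent ∞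
      (fun x => (⟨x, coneVec I x (a x, v x)⟩ : TangentBundle (𝓘(ℝ, ℝ).prod I) (Cone N))) x₀ := by
  have h1 : ContMDiffAt (𝓘(ℝ, ℝ).prod I) 𝓘(ℝ, ℝ).tangent ∞
      (fun x => (⟨x.1, a x⟩ : TangentBundle 𝓘(ℝ, ℝ) PosReal)) x₀ := by
    rw [contMDiffAt_totalSpace]
    refine ⟨contMDiffAt_fst, ?_⟩
    refine ha.congr_of_eventuallyEq ?_
    filter_upwards with x
    exact trivializationAt_posReal x₀.1 x.1 (a x)
  exact ((contMDiff_equivTangentBundleProd_symm (I := 𝓘(ℝ, ℝ)) (M := PosReal) (I' := I)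
    (M' := N)).contMDiffAt).comp x₀ (h1.prodMk hv)

theorem contMDiff_coneInner [FiniteDimensional ℝ E] (g : RiemMetric I N) :
    ContMDiff (𝓘(ℝ, ℝ).prod I) ((𝓘(ℝ, ℝ).prod I).prod 𝓘(ℝ, (ℝ × E) →L[ℝ] (ℝ × E) →L[ℝ] ℝ)) ∞
      (fun x : Cone N => TotalSpace.mk' ((ℝ × E) →L[ℝ] (ℝ × E) →L[ℝ] ℝ)
        (E := fun x : Cone N => TangentSpace (𝓘(ℝ, ℝ).prod I) x →L[ℝ]
          TangentSpace (𝓘(ℝ, ℝ).prod I) x →L[ℝ] ℝ)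
        x (coneInner I x (g.inner x.2))) := by
  intro x₀
  refine contMDiffAt_hom (F₁ := ℝ × E) (F₂ := (ℝ × E) →L[ℝ] ℝ) _ x₀ fun X hX => ?_
  refine contMDiffAt_hom (F₁ := ℝ × E) (F₂ := ℝ) (V₂ := Bundle.Trivial (Cone N) ℝ) _ x₀ fun Y hY => ?_
  rw [contMDiffAt_totalSpace]
  refine ⟨contMDiffAt_id, ?_⟩
  have hr : ContMDiffAt (𝓘(ℝ, ℝ).prod I) 𝓘(ℝ, ℝ) ∞ (fun y : Cone N => (y.1 : ℝ)) x₀ :=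
    (contMDiff_subtype_val.comp contMDiff_fst).contMDiffAt
  have hg : ContMDiffAt (𝓘(ℝ, ℝ).prod I) 𝓘(ℝ, ℝ) ∞
      (fun x : Cone N => g.inner x.2 (dπ I x (X x)) (dπ I x (Y x))) x₀ := by
    have h3 := ContMDiffAt.clm_bundle_apply₂ (F₁ := E) (F₂ := E) (F₃ := ℝ)
      (E₃ := Bundle.Trivial N ℝ) (b := fun x : Cone N => x.2)
      ((g.contMDiff.contMDiffAt).comp x₀ contMDiffAt_snd) (contMDiffAt_dπ x₀ X hX)
      (contMDiffAt_dπ x₀ Y hY)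
    exact (contMDiffAt_totalSpace.1 h3).2
  exact ((contMDiffAt_dr x₀ X hX).mul (contMDiffAt_dr x₀ Y hY)).add ((hr.pow 2).mul hg)

end Smooth

variable [IsManifold I ∞ N]

theorem coneInner_pos (g : RiemMetric I N) (x : Cone N)
    (X : TangentSpace (𝓘(ℝ, ℝ).prod I) x) (hX : X ≠ 0) : 0 < coneInner I x (g.inner x.2) X X := by
  have hr : (0 : ℝ) < (x.1 : ℝ) ^ 2 := pow_pos x.1.2 2
  rw [coneInner_apply]
  by_cases h : dπ I x X = 0
  · have h' : dr I x X ≠ 0 := by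
      intro h'
      apply hX
      rw [← coneVec_dr_dπ x X, h, h', Prod.mk_zero_zero, map_zero]
    rw [h, map_zero, mul_zero, add_zero]
    exact mul_self_pos.2 h'
  · have := g.pos x.2 _ h
    nlinarith [mul_self_nonneg (dr I x X), mul_pos hr this]

theorem inner_self_nonneg (g : RiemMetric I N) (p : N) (v : TangentSpace I p) :
    0 ≤ g.inner p v v := by
  by_cases hv : v = 0
  · rw [hv, map_zero]
  · exact (g.pos p v hv).le

section Bounded

open scoped Pointwise

theorem coneInner_bounded (g : RiemMetric I N) (x : Cone N) :
    Bornology.IsVonNBounded ℝ {X : TangentSpace (𝓘(ℝ, ℝ).prod I) x |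
      coneInner I x (g.inner x.2) X X < 1} := by
  have hr : (0 : ℝ) < x.1 := x.1.2
  let S : Set E := {v : TangentSpace I x.2 | g.inner x.2 v v < 1}
  have hS : Bornology.IsBounded S := (NormedSpace.isVonNBounded_iff ℝ).1 (g.isVonNBounded x.2)
  let T : Set (ℝ × E) := {X : TangentSpace (𝓘(ℝ, ℝ).prod I) x |
    coneInner I x (g.inner x.2) X X < 1}
  have key : ∀ (a : ℝ) (v : TangentSpace I x.2),
      coneInner I x (g.inner x.2) (coneVec I x (a, v)) (coneVec I x (a, v)) < 1 →
      a ∈ Icc (-1 : ℝ) 1 ∧ g.inner x.2 ((x.1 : ℝ) • v) ((x.1 : ℝ) • v) < 1 := by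
    intro a v h
    rw [coneInner_apply, dr_coneVec, dπ_coneVec] at h
    have h3 := mul_nonneg (sq_nonneg (x.1 : ℝ)) (inner_self_nonneg g x.2 v)
    rw [map_smul, map_smul, smul_apply, smul_eq_mul, smul_eq_mul]
    refine ⟨⟨?_, ?_⟩, ?_⟩ <;> nlinarith [mul_self_nonneg a]
  have hT : T ⊆ Icc (-1 : ℝ) 1 ×ˢ ((x.1 : ℝ)⁻¹ • S) := by
    rintro ⟨a, v⟩ hX
    exact ⟨(key a v hX).1, (mem_inv_smul_set_iff₀ hr.ne' S v).2 (key a v hX).2⟩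
  have hT' : Bornology.IsBounded T :=
    ((Metric.isBounded_Icc _ _).prod (hS.smul₀ _)).subset hT
  exact (NormedSpace.isVonNBounded_iff ℝ (s := T)).2 hT'

end Bounded

/-- The cone metric `dr² + r² g`. -/
def coneMetric [FiniteDimensional ℝ E] (g : RiemMetric I N) : RiemMetric (𝓘(ℝ, ℝ).prod I) (Cone N) where
  inner x := coneInner I x (g.inner x.2)
  symm x X Y := by
    rw [coneInner_apply, coneInner_apply, g.symm, mul_comm (dr I x X)]
  pos := coneInner_pos g
  isVonNBounded := coneInner_bounded g
  contMDiff := contMDiff_coneInner g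

namespace AlmostContactMetric

variable (S : AlmostContactMetric I N)

/-- The almost complex structure of the cone, determined by
`J (∂/∂r) = ξ / r`, `J ξ = - r ∂/∂r` and `J = φ` on `ker η`. -/
def coneJ (x : Cone N) :
    TangentSpace (𝓘(ℝ, ℝ).prod I) x →L[ℝ] TangentSpace (𝓘(ℝ, ℝ).prod I) x :=
  (coneVec I x).comp
    ((-(x.1 : ℝ) • (S.η x.2).comp (dπ I x)).prod
      ((S.φ x.2).comp (dπ I x) + (x.1 : ℝ)⁻¹ • (dr I x).smulRight (S.ξ x.2)))

theorem coneJ_apply (x : Cone N) (X : TangentSpace (𝓘(ℝ, ℝ).prod I) x) :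
    S.coneJ x X = coneVec I x (-(x.1 : ℝ) * S.η x.2 (dπ I x X),
      S.φ x.2 (dπ I x X) + ((x.1 : ℝ)⁻¹ * dr I x X) • S.ξ x.2) := by
  rw [mul_smul]
  rfl

/-- The almost Hermitian structure of the cone over an almost contact metric manifold. -/
def cone [FiniteDimensional ℝ E] : AlmostHermitian (𝓘(ℝ, ℝ).prod I) (Cone N) where
  g := coneMetric S.g
  J := S.coneJ
  smooth_J := by
    intro x₀
    refine contMDiffAt_hom (F₁ := ℝ × E) (F₂ := ℝ × E) _ x₀ fun X hX => ?_
    have hr : ContMDiffAt (𝓘(ℝ, ℝ).prod I) 𝓘(ℝ, ℝ) ∞ (fun y : Cone N => (y.1 : ℝ)) x₀ :=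
      (contMDiff_subtype_val.comp contMDiff_fst).contMDiffAt
    have hr0 : (x₀.1 : ℝ) ≠ 0 := (show (0 : ℝ) < x₀.1 from x₀.1.2).ne'
    have hξ : ContMDiffAt (𝓘(ℝ, ℝ).prod I) I.tangent ∞
        (fun x : Cone N => (⟨x.2, S.ξ x.2⟩ : TangentBundle I N)) x₀ :=
      S.smooth_ξ.contMDiffAt.comp x₀ contMDiffAt_snd
    have hπ := contMDiffAt_dπ x₀ X hX
    have hη : ContMDiffAt (𝓘(ℝ, ℝ).prod I) 𝓘(ℝ, ℝ) ∞
        (fun x : Cone N => S.η x.2 (dπ I x (X x))) x₀ := by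
      have h3 := ContMDiffAt.clm_bundle_apply₂ (F₁ := E) (F₂ := E) (F₃ := ℝ)
        (E₃ := Bundle.Trivial N ℝ) (b := fun x : Cone N => x.2)
        ((S.g.contMDiff.contMDiffAt).comp x₀ contMDiffAt_snd) hξ hπ
      exact (contMDiffAt_totalSpace.1 h3).2
    have hφ : ContMDiffAt (𝓘(ℝ, ℝ).prod I) I.tangent ∞
        (fun x : Cone N => (⟨x.2, S.φ x.2 (dπ I x (X x))⟩ : TangentBundle I N)) x₀ :=
      ContMDiffAt.clm_bundle_apply (F₁ := E) (F₂ := E) (b := fun x : Cone N => x.2)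
        (S.smooth_φ.contMDiffAt.comp x₀ contMDiffAt_snd) hπ
    have hc : ContMDiffAt (𝓘(ℝ, ℝ).prod I) 𝓘(ℝ, ℝ) ∞
        (fun x : Cone N => (x.1 : ℝ)⁻¹ * dr I x (X x)) x₀ :=
      (hr.inv₀ hr0).mul (contMDiffAt_dr x₀ X hX)
    have h1 := contMDiffAt_coneVec x₀ _ _ (hr.neg.mul hη) hφ
    have h2 := contMDiffAt_coneVec x₀ (fun _ => 0) _ contMDiffAt_const hξ
    have h3 := h1.add_section (hc.smul_section h2)
    refine h3.congr_of_eventuallyEq ?_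
    filter_upwards with x
    rw [coneJ_apply]
    simp only [Pi.add_apply, Pi.smul_apply', TotalSpace.mk']
    rw [← map_smul, ← map_add]
    simp
  J_J x X := by
    have hr0 : (x.1 : ℝ) ≠ 0 := (show (0 : ℝ) < x.1 from x.1.2).ne'
    have h1 : dπ I x (S.coneJ x X) = S.φ x.2 (dπ I x X) + ((x.1 : ℝ)⁻¹ * dr I x X) • S.ξ x.2 := by
      rw [coneJ_apply, dπ_coneVec]
    have h2 : dr I x (S.coneJ x X) = -(x.1 : ℝ) * S.η x.2 (dπ I x X) := by
      rw [coneJ_apply, dr_coneVec]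
    rw [coneJ_apply, h1, h2, map_add, map_smul, S.η_φ, S.η_ξ, map_add, S.φ_φ, map_smul, S.φ_ξ]
    have h3 : S.g.inner x.2 (S.ξ x.2) (dπ I x X) = S.η x.2 (dπ I x X) := rfl
    conv_rhs => rw [← coneVec_dr_dπ x X, ← map_neg]
    rw [h3]
    congr 1
    ext
    · simp only [Prod.fst_neg, smul_eq_mul]
      field_simp
      ring
    · simp only [Prod.snd_neg, smul_zero, add_zero]
      rw [add_assoc, ← add_smul]
      field_simp
      simp
  compat x X Y := by
    have hr0 : (x.1 : ℝ) ≠ 0 := (show (0 : ℝ) < x.1 from x.1.2).ne'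
    have h1 : ∀ X, dπ I x (S.coneJ x X) = S.φ x.2 (dπ I x X) + ((x.1 : ℝ)⁻¹ * dr I x X) • S.ξ x.2 := by
      intro X
      rw [coneJ_apply, dπ_coneVec]
    have h2 : ∀ X, dr I x (S.coneJ x X) = -(x.1 : ℝ) * S.η x.2 (dπ I x X) := by
      intro X
      rw [coneJ_apply, dr_coneVec]
    have h3 : ∀ v, S.g.inner x.2 (S.ξ x.2) v = S.η x.2 v := fun v => rfl
    have h4 : ∀ v, S.g.inner x.2 v (S.ξ x.2) = S.η x.2 v := fun v => S.g.symm ..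
    change coneInner I x _ _ _ = coneInner I x _ _ _
    rw [coneInner_apply, coneInner_apply, h1, h2, h1, h2]
    simp only [map_add, map_smul, add_apply, smul_apply, smul_eq_mul, S.compat, h3, h4, S.η_φ,
      S.η_ξ]
    field_simp
    ring

/-- The `3`-form `r² (η ∧ (dη - 2F) + d^φ F)` on the cone. -/
def coneTorsion : DiffForm (𝓘(ℝ, ℝ).prod I) (Cone N) 3 := fun x =>
  (x.1 : ℝ) ^ 2 • (wedge (S.η x.2) (S.dη x.2 - (2 : ℝ) • S.F x.2)
    + S.dφF x.2).compContinuousLinearMap (dπ I x)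

/-- The `2`-form `r dr ∧ η + r² F` on the cone. -/
def coneForm : DiffForm (𝓘(ℝ, ℝ).prod I) (Cone N) 2 := fun x =>
  (x.1 : ℝ) • wedge (dr I x) (oneForm ((S.η x.2).comp (dπ I x)))
    + (x.1 : ℝ) ^ 2 • (S.F x.2).compContinuousLinearMap (dπ I x)

end AlmostContactMetric

end Cone

end TorsionGeometry

end

open TorsionGeometry

/-!
A Hermitian connection with totally skew torsion `c` on an almost Hermitian manifold with integrable
`J` is determined by `c` through the Koszul formula; comparing the torsion with `∇J = 0` forces
`c = dω(J·, J·, J·)`, and this `c` does give a Hermitian connection. So KT means that `J` is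
integrable, with torsion `dω(J·, J·, J·)`, and SKT means moreover that this form is closed.

On the cone every tangent vector is the value of a field `f r∂_r + V` with `f` and `V` pulled back
from `N`, and `[f r∂_r + V, g r∂_r + W] = (V g - W f) r∂_r + [V, W]`. The Nijenhuis tensor of `J_𝒞`
vanishes on `(r∂_r, V)` since `ξ` is Killing and on `(V, W)` by normality. The same brackets give
`dω_𝒞`, hence `dω_𝒞(J·, J·, J·) = r² τ` with `τ = η ∧ (dη - 2F) + d^φ F`.

Since `ι_{r∂_r}(r² τ) = 0`, Cartan's formula gives `ι_{r∂_r} d(r² τ) = 2 r² τ`, so `r² τ` is closed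
iff `τ = 0`. Inserting `ξ` in `τ = 0` yields `dη = 2F`; conversely `dη = 2F` makes `F = dη / 2`
closed, so both terms of `τ` vanish.
-/

noncomputable section

namespace TorsionGeometry

section AlternatingForms

variable {R V W : Type*} [Semiring R] [AddCommMonoid V] [Module R V] [TopologicalSpace V]
  [AddCommGroup W] [Module R W] [TopologicalSpace W] {n : ℕ}

theorem map_swap_fst_snd (α : V [⋀^Fin (n + 2)]→L[R] W) (a b : V) (v : Fin n → V) :
    α (Matrix.vecCons b (Matrix.vecCons a v)) = -α (Matrix.vecCons a (Matrix.vecCons b v)) := by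
  refine Eq.trans (congrArg α (funext fun i => ?_)) (α.toAlternatingMap.map_swap
    (Matrix.vecCons a (Matrix.vecCons b v)) (i := 0) (j := Fin.succ 0)
    (Fin.succ_ne_zero _).symm)
  refine Fin.cases rfl (Fin.cases rfl fun l => ?_) i
  rw [Function.comp_apply, Equiv.swap_apply_of_ne_of_ne (Fin.succ_ne_zero _)
    ((Fin.succ_injective _).ne (Fin.succ_ne_zero _))]
  rfl

theorem map_swap_snd_thd (α : V [⋀^Fin (n + 3)]→L[R] W) (a b c : V) (v : Fin n → V) :
    α (Matrix.vecCons a (Matrix.vecCons c (Matrix.vecCons b v)))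
      = -α (Matrix.vecCons a (Matrix.vecCons b (Matrix.vecCons c v))) := by
  refine Eq.trans (congrArg α (funext fun i => ?_)) (α.toAlternatingMap.map_swap
    (Matrix.vecCons a (Matrix.vecCons b (Matrix.vecCons c v)))
    (i := Fin.succ 0) (j := Fin.succ (Fin.succ 0))
    ((Fin.succ_injective _).ne (Fin.succ_ne_zero _).symm))
  refine Fin.cases rfl (Fin.cases rfl (Fin.cases rfl fun l => ?_)) i
  rw [Function.comp_apply, Equiv.swap_apply_of_ne_of_ne
    ((Fin.succ_injective _).ne (Fin.succ_ne_zero _))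
    ((Fin.succ_injective _).ne ((Fin.succ_injective _).ne (Fin.succ_ne_zero _)))]
  rfl

theorem map_rotate (α : V [⋀^Fin (n + 3)]→L[R] W) (a b c : V) (v : Fin n → V) :
    α (Matrix.vecCons b (Matrix.vecCons c (Matrix.vecCons a v)))
      = α (Matrix.vecCons a (Matrix.vecCons b (Matrix.vecCons c v))) := by
  rw [map_swap_snd_thd, map_swap_fst_snd, neg_neg]

theorem map_snd_add (α : V [⋀^Fin (n + 2)]→L[R] W) (a b b' : V) (v : Fin n → V) :
    α (Matrix.vecCons a (Matrix.vecCons (b + b') v))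
      = α (Matrix.vecCons a (Matrix.vecCons b v)) + α (Matrix.vecCons a (Matrix.vecCons b' v)) := by
  simp only [map_swap_fst_snd α _ a, α.vecCons_add, neg_add]

theorem map_snd_smul (α : V [⋀^Fin (n + 2)]→L[R] W) (r : R) (a b : V) (v : Fin n → V) :
    α (Matrix.vecCons a (Matrix.vecCons (r • b) v))
      = r • α (Matrix.vecCons a (Matrix.vecCons b v)) := by
  simp only [map_swap_fst_snd α _ a, α.vecCons_smul, smul_neg]

theorem map_thd_add (α : V [⋀^Fin (n + 3)]→L[R] W) (a b c c' : V) (v : Fin n → V) :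
    α (Matrix.vecCons a (Matrix.vecCons b (Matrix.vecCons (c + c') v)))
      = α (Matrix.vecCons a (Matrix.vecCons b (Matrix.vecCons c v)))
        + α (Matrix.vecCons a (Matrix.vecCons b (Matrix.vecCons c' v))) := by
  simp only [map_rotate α _ a b, α.vecCons_add]

theorem map_thd_smul (α : V [⋀^Fin (n + 3)]→L[R] W) (r : R) (a b c : V) (v : Fin n → V) :
    α (Matrix.vecCons a (Matrix.vecCons b (Matrix.vecCons (r • c) v)))
      = r • α (Matrix.vecCons a (Matrix.vecCons b (Matrix.vecCons c v))) := by
  simp only [map_rotate α _ a b, α.vecCons_smul]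

theorem map_add_smul_of_forall_map_eq_zero {α : V [⋀^Fin 3]→L[R] W} {z : V}
    (hz : ∀ u v, α ![z, u, v] = 0) (u v w : V) (a b c : R) :
    α ![u + a • z, v + b • z, w + c • z] = α ![u, v, w] := by
  have hz_snd : ∀ u v, α ![u, z, v] = 0 := fun u v => by rw [map_swap_fst_snd, hz, neg_zero]
  have hz_thd : ∀ u v, α ![u, v, z] = 0 := fun u v => by rw [← map_rotate, hz_snd]
  simp only [α.vecCons_add, α.vecCons_smul, map_snd_add, map_snd_smul, map_thd_add, map_thd_smul,
    hz, hz_snd, hz_thd, smul_zero, add_zero]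

end AlternatingForms

section Neg

variable {R : Type*} [CommRing R] {V : Type*} [AddCommGroup V] [Module R V] [TopologicalSpace V]
  {W : Type*} [AddCommGroup W] [Module R W] [TopologicalSpace W] {n : ℕ}

theorem map_snd_neg (α : V [⋀^Fin (n + 2)]→L[R] W) (a b : V) (v : Fin n → V) :
    α (Matrix.vecCons a (Matrix.vecCons (-b) v)) = -α (Matrix.vecCons a (Matrix.vecCons b v)) := by
  rw [← neg_one_smul R b, map_snd_smul, neg_one_smul]

theorem map_thd_neg (α : V [⋀^Fin (n + 3)]→L[R] W) (a b c : V) (v : Fin n → V) :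
    α (Matrix.vecCons a (Matrix.vecCons b (Matrix.vecCons (-c) v)))
      = -α (Matrix.vecCons a (Matrix.vecCons b (Matrix.vecCons c v))) := by
  rw [← neg_one_smul R c, map_thd_smul, neg_one_smul]

end Neg

section Wedge

variable {V : Type*} [AddCommGroup V] [Module ℝ V] [TopologicalSpace V] (α : V →L[ℝ] ℝ)

theorem wedge_oneForm_apply (β : V →L[ℝ] ℝ) (a b : V) :
    wedge α (oneForm β) ![a, b] = α a * β b - α b * β a := by
  have hoff : ∀ v : Fin 1 → V, oneForm β v = β (v 0) := fun _ => rfl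
  simp [wedge_apply, Fin.sum_univ_two, hoff, Fin.removeNth, sub_eq_add_neg]

theorem wedge_apply_three (β : V [⋀^Fin 2]→L[ℝ] ℝ) (a b c : V) :
    wedge α β ![a, b, c] = α a * β ![b, c] - α b * β ![a, c] + α c * β ![a, b] := by
  have removeNth_one : (1 : Fin 3).removeNth ![a, b, c] = ![a, c] := (FinVec.etaExpand_eq _).symm
  have removeNth_two : (2 : Fin 3).removeNth ![a, b, c] = ![a, b] := (FinVec.etaExpand_eq _).symm
  have removeNth_zero : (0 : Fin 3).removeNth ![a, b, c] = ![b, c] := (FinVec.etaExpand_eq _).symm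
  simp [wedge_apply, Fin.sum_univ_three, removeNth_zero, removeNth_one, removeNth_two,
    sub_eq_add_neg]

end Wedge

section Fields

variable {E : Type*} [NormedAddCommGroup E] [NormedSpace ℝ E]
  {H : Type*} [TopologicalSpace H] {I : ModelWithCorners ℝ E H}
  {M : Type*} [TopologicalSpace M] [ChartedSpace H M]

theorem mvfderiv_congr {f f' : M → ℝ} {x : M} (h : f =ᶠ[𝓝 x] f') :
    mvfderiv I f x = mvfderiv I f' x := by
  simp only [mvfderiv, h.mfderiv_eq]
  rfl

variable [IsManifold I ∞ M]

theorem isManifold_one : IsManifold I 1 M := IsManifold.of_le (n := ∞) (by norm_cast)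

theorem isManifold_two : IsManifold I 2 M := IsManifold.of_le (n := ∞) (by norm_cast)

/-- Differentiability at `x` of a vector field. -/
abbrev MDiffField (V : Π y : M, TangentSpace I y) (x : M) : Prop :=
  MDifferentiableAt I I.tangent (fun y => (⟨y, V y⟩ : TangentBundle I M)) x

/-- Smoothness at `x`, hence near `x`, of a vector field. -/
abbrev SmoothField (V : Π y : M, TangentSpace I y) (x : M) : Prop :=
  ContMDiffAt I I.tangent ∞ (fun y => (⟨y, V y⟩ : TangentBundle I M)) x

theorem exists_smoothField_eq {x : M} (v : TangentSpace I x) :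
    ∃ V : Π y : M, TangentSpace I y, SmoothField V x ∧ V x = v :=
  ⟨FiberBundle.extend E v, FiberBundle.contMDiffAt_extend I E v, FiberBundle.extend_apply_self ..⟩

variable {V W : Π y : M, TangentSpace I y} {f : M → ℝ} {x : M}

theorem SmoothField.mdiff (hV : SmoothField V x) : MDiffField V x :=
  hV.mdifferentiableAt (by simp)

theorem eventually_mdifferentiableAt (hf : ContMDiffAt I 𝓘(ℝ, ℝ) ∞ f x) :
    ∀ᶠ y in 𝓝 x, MDifferentiableAt I 𝓘(ℝ, ℝ) f y := by
  have := isManifold_one (I := I) (M := M)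
  filter_upwards [(contMDiffAt_iff_contMDiffAt_nhds (n := 1) (by simp)).1 (hf.of_le (by norm_cast))]
    with y hy
  exact hy.mdifferentiableAt (by simp)

theorem SmoothField.eventually_mdiff (hV : SmoothField V x) : ∀ᶠ y in 𝓝 x, MDiffField V y := by
  have := isManifold_one (I := I) (M := M)
  filter_upwards [(contMDiffAt_iff_contMDiffAt_nhds (n := 1) (by simp)).1 (hV.of_le (by norm_cast))]
    with y hy
  exact hy.mdifferentiableAt (by simp)

theorem contMDiffAt_mvfderiv (hf : ContMDiffAt I 𝓘(ℝ, ℝ) ∞ f x) (hV : SmoothField V x) :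
    ContMDiffAt I 𝓘(ℝ, ℝ) ∞ (fun y => mvfderiv I f y (V y)) x := by
  have := isManifold_one (I := I) (M := M)
  exact (contMDiff_snd_tangentBundle_modelSpace ℝ 𝓘(ℝ, ℝ)).contMDiffAt.comp x <|
    ContMDiffAt.clm_apply_of_inCoordinates (b₁ := id) (b₂ := f)
      (hf.mfderiv_const (m := ∞) (by simp)) hV hf

theorem SmoothField.mlieBracket [CompleteSpace E] (hV : SmoothField V x) (hW : SmoothField W x) :
    SmoothField (VectorField.mlieBracket I V W) x := by
  have : IsManifold I (((⊤ : ℕ∞) : ℕ∞ω) + 1) M := (inferInstance : IsManifold I ∞ M)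
  have : IsManifold I (minSmoothness ℝ 2) M := by
    rw [minSmoothness_of_isRCLikeNormedField]
    exact isManifold_two
  exact ContMDiffAt.mlieBracket_vectorField (n := ⊤) (m := ⊤) hV hW (by simp)

section Endomorphism

variable {J : Π x : M, TangentSpace I x →L[ℝ] TangentSpace I x}
  (hJ : ContMDiff I (I.prod 𝓘(ℝ, E →L[ℝ] E)) ∞
    (fun x => TotalSpace.mk' (E →L[ℝ] E) (E := fun y : M => TangentSpace I y →L[ℝ] TangentSpace I y)
      x (J x)))

include hJ

theorem SmoothField.endo (hV : SmoothField V x) : SmoothField (fun y => J y (V y)) x :=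
  ContMDiffAt.clm_bundle_apply (F₁ := E) (F₂ := E) (b := fun y : M => y) hJ.contMDiffAt hV

theorem MDiffField.endo (hV : MDiffField V x) : MDiffField (fun y => J y (V y)) x :=
  MDifferentiableAt.clm_bundle_apply (F₁ := E) (F₂ := E) (b := fun y : M => y)
    (hJ.contMDiffAt.mdifferentiableAt (by simp)) hV

end Endomorphism

end Fields

section Forms

variable {E : Type*} [NormedAddCommGroup E] [NormedSpace ℝ E]
  {H : Type*} [TopologicalSpace H] {I : ModelWithCorners ℝ E H}
  {M : Type*} [TopologicalSpace M] [ChartedSpace H M]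

/-- The derivative of the inverse of the preferred chart at `x`. -/
def chartSymmD (I : ModelWithCorners ℝ E H) {M : Type*} [TopologicalSpace M] [ChartedSpace H M]
    (x : M) (y : E) : E →L[ℝ] TangentSpace I ((extChartAt I x).symm y) :=
  mfderivWithin 𝓘(ℝ, E) I (extChartAt I x).symm (range I) y

/-- The expression of a form in the preferred chart at `x`. -/
def chartForm {k : ℕ} (α : DiffForm I M k) (x : M) (y : E) : E [⋀^Fin k]→L[ℝ] ℝ :=
  (α ((extChartAt I x).symm y)).compContinuousLinearMap (chartSymmD I x y)

/-- The expression of a vector field in the preferred chart at `x`. -/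
def chartField (V : Π y : M, TangentSpace I y) (x : M) (y : E) : E :=
  VectorField.mpullbackWithin 𝓘(ℝ, E) I (extChartAt I x).symm V (range I) y

theorem field_congr (V : Π y : M, TangentSpace I y) {x y : M} (h : y = x) :
    (V y : E) = (V x : E) := by
  subst h
  rfl

theorem form_congr {k : ℕ} (α : DiffForm I M k) {x y : M} (h : y = x) {v w : Fin k → E}
    (hvw : v = w) :
    (α y : E [⋀^Fin k]→L[ℝ] ℝ) v = (α x : E [⋀^Fin k]→L[ℝ] ℝ) w := by
  subst h hvw
  rfl

variable [IsManifold I ∞ M]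

theorem extD_eq_extDerivWithin_chartForm {k : ℕ} (α : DiffForm I M k) (x : M)
    (v : Fin (k + 1) → TangentSpace I x) :
    extD α x v = extDerivWithin (chartForm α x) (range I) (extChartAt I x x) v := by
  have := isManifold_one (I := I) (M := M)
  exact congrArg (extDerivWithin (chartForm α x) (range I) (extChartAt I x x)) (funext fun i =>
    congrArg (fun A : E →L[ℝ] E => A (v i)) mfderiv_extChartAt_self)

theorem chartSymmD_chartField (V : Π y : M, TangentSpace I y) (x : M) {y : E}
    (hy : y ∈ (extChartAt I x).target) :
    chartSymmD I x y (chartField V x y) = V ((extChartAt I x).symm y) := by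
  have := isManifold_one (I := I) (M := M)
  exact (isInvertible_mfderivWithin_extChartAt_symm hy).self_apply_inverse _

theorem chartForm_chartField {k : ℕ} (α : DiffForm I M k) (V : Fin k → Π y : M, TangentSpace I y)
    (x : M) {y : E} (hy : y ∈ (extChartAt I x).target) :
    chartForm α x y (fun i => chartField (V i) x y)
      = α ((extChartAt I x).symm y) (fun i => V i ((extChartAt I x).symm y)) :=
  congrArg (α ((extChartAt I x).symm y)) (funext fun i => chartSymmD_chartField (V i) x hy)

theorem eventuallyEq_chartForm_chartField {k : ℕ} (α : DiffForm I M k)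
    (V : Fin k → Π y : M, TangentSpace I y) (x : M) :
    (fun y => chartForm α x y (fun i => chartField (V i) x y)) =ᶠ[𝓝[range I] (extChartAt I x x)]
      fun y => α ((extChartAt I x).symm y) (fun i => V i ((extChartAt I x).symm y)) := by
  filter_upwards [extChartAt_target_mem_nhdsWithin x] with y hy
  exact chartForm_chartField α V x hy

theorem chartField_self (V : Π y : M, TangentSpace I y) (x : M) :
    chartField V x (extChartAt I x x) = V x := by
  have := isManifold_one (I := I) (M := M)
  exact (mfderivWithin_extChartAt_symm_inverse_apply (I := I) (x := x)
    (V ((extChartAt I x).symm (extChartAt I x x)) : E)).trans (field_congr V (extChartAt_to_inv x))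

theorem chartForm_self {k : ℕ} (α : DiffForm I M k) (x : M) (v : Fin k → TangentSpace I x) :
    chartForm α x (extChartAt I x x) v = α x v := by
  have := isManifold_one (I := I) (M := M)
  exact form_congr α (extChartAt_to_inv x) (funext fun i =>
    congrArg (fun A : E →L[ℝ] E => A (v i)) (mfderivWithin_range_extChartAt_symm (x := x)))

theorem mlieBracket_eq_lieBracketWithin_chartField (V W : Π y : M, TangentSpace I y) (x : M) :
    VectorField.mlieBracket I V W x = VectorField.lieBracketWithin ℝ (chartField V x)
      (chartField W x) (range I) (extChartAt I x x) := by
  have := isManifold_one (I := I) (M := M)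
  rw [← VectorField.mlieBracketWithin_univ, VectorField.mlieBracketWithin_apply,
    mfderiv_extChartAt_self]
  simp only [preimage_univ, univ_inter]
  exact congrArg (fun A : E →L[ℝ] E => A _) ContinuousLinearMap.inverse_id

theorem MDiffField.differentiableWithinAt_chartField [CompleteSpace E]
    {V : Π y : M, TangentSpace I y} {x : M} (hV : MDiffField V x) :
    DifferentiableWithinAt ℝ (chartField V x) (range I) (extChartAt I x x) := by
  have := isManifold_one (I := I) (M := M)
  have := isManifold_two (I := I) (M := M)
  have h := (mdifferentiableWithinAt_univ.2 hV).differentiableWithinAt_mpullbackWithin_vectorField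
  simp only [preimage_univ, univ_inter] at h
  exact h

section CoordinateChange

variable {k : ℕ} {x p : M} {y : E}

theorem eventually_mem_coordChange_source (hy : y ∈ (extChartAt I x).target)
    (hp : (extChartAt I x).symm y ∈ (extChartAt I p).source) :
    ∀ᶠ z in 𝓝[range I] y,
      z ∈ (extChartAt I x).target ∧ (extChartAt I x).symm z ∈ (extChartAt I p).source := by
  have := isManifold_one (I := I) (M := M)
  exact Filter.Eventually.and (extChartAt_target_mem_nhdsWithin_of_mem hy)
    ((mdifferentiableWithinAt_extChartAt_symm hy).continuousWithinAt
      ((isOpen_extChartAt_source p).mem_nhds hp))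

theorem fderivWithin_coordChange (hy : y ∈ (extChartAt I x).target)
    (hp : (extChartAt I x).symm y ∈ (extChartAt I p).source) :
    fderivWithin ℝ (extChartAt I p ∘ (extChartAt I x).symm) (range I) y
      = (mfderiv I 𝓘(ℝ, E) (extChartAt I p) ((extChartAt I x).symm y)).comp
        (chartSymmD I x y) := by
  have := isManifold_one (I := I) (M := M)
  rw [← mfderivWithin_eq_fderivWithin]
  exact mfderiv_comp_mfderivWithin y
    (mdifferentiableAt_extChartAt (by rwa [extChartAt_source] at hp))
    (mdifferentiableWithinAt_extChartAt_symm hy)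
    (I.uniqueDiffOn _ (extChartAt_target_subset_range x hy)).uniqueMDiffWithinAt

theorem chartSymmD_fderivWithin_coordChange (hy : y ∈ (extChartAt I x).target)
    (hp : (extChartAt I x).symm y ∈ (extChartAt I p).source) (v : E) :
    (chartSymmD I p ((extChartAt I p ∘ (extChartAt I x).symm) y)
      (fderivWithin ℝ (extChartAt I p ∘ (extChartAt I x).symm) (range I) y v) : E)
      = chartSymmD I x y v := by
  have := isManifold_one (I := I) (M := M)
  have hsymm : (extChartAt I p).symm ∘ (extChartAt I p ∘ (extChartAt I x).symm)
      =ᶠ[𝓝[range I] y] (extChartAt I x).symm := by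
    filter_upwards [eventually_mem_coordChange_source hy hp] with z hz
    exact (extChartAt I p).left_inv hz.2
  have hchain := mfderivWithin_comp (I := 𝓘(ℝ, E)) (I' := 𝓘(ℝ, E)) (I'' := I) (u := range I) y
    (mdifferentiableWithinAt_extChartAt_symm ((extChartAt I p).map_source hp))
    ((mdifferentiableAt_extChartAt (by rwa [extChartAt_source] at hp)).comp_mdifferentiableWithinAt
      y (mdifferentiableWithinAt_extChartAt_symm hy))
    (fun z _ => mem_range_self _)
    (I.uniqueDiffOn _ (extChartAt_target_subset_range x hy)).uniqueMDiffWithinAt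
  rw [mfderivWithin_eq_fderivWithin,
    hsymm.mfderivWithin_eq_of_mem (extChartAt_target_subset_range x hy)] at hchain
  exact (congrArg (fun A : E →L[ℝ] E => A v) hchain).symm

theorem chartForm_eq_comp_coordChange (α : DiffForm I M k) (hy : y ∈ (extChartAt I x).target)
    (hp : (extChartAt I x).symm y ∈ (extChartAt I p).source) :
    chartForm α x y
      = (chartForm α p ((extChartAt I p ∘ (extChartAt I x).symm) y)).compContinuousLinearMap
        (fderivWithin ℝ (extChartAt I p ∘ (extChartAt I x).symm) (range I) y) := by
  ext v
  exact (form_congr α ((extChartAt I p).left_inv hp)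
    (funext fun i => chartSymmD_fderivWithin_coordChange hy hp (v i))).symm

end CoordinateChange

theorem chartSymmD_apply_eq_extend (x : M) (v : TangentSpace I x) {y : E}
    (hy : y ∈ (extChartAt I x).target) :
    chartSymmD I x y v = FiberBundle.extend E v ((extChartAt I x).symm y) := by
  have := isManifold_one (I := I) (M := M)
  have hy_source : (extChartAt I x).symm y ∈ (chartAt H x).source := by
    simpa using (extChartAt I x).map_target hy
  have symmL_eq := TangentBundle.symmL_trivializationAt (I := I) hy_source
  rw [(extChartAt I x).right_inv hy] at symmL_eq
  have triv_self : (trivializationAt E (TangentSpace I) x ⟨x, v⟩).2 = v := by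
    rw [TangentBundle.trivializationAt_apply]
    exact tangentCoordChange_self (I := I) (mem_extChartAt_source x)
  calc chartSymmD I x y v
      = (trivializationAt E (TangentSpace I) x).symmL ℝ ((extChartAt I x).symm y) v :=
        (congrArg (fun A : E →L[ℝ] E => A v) symmL_eq).symm
    _ = (trivializationAt E (TangentSpace I) x).symm ((extChartAt I x).symm y) v :=
        Trivialization.symmL_apply (R := ℝ) _ (by simpa using hy_source) _
    _ = FiberBundle.extend E v ((extChartAt I x).symm y) :=
        (congrArg ((trivializationAt E (TangentSpace I) x).symm ((extChartAt I x).symm y))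
          triv_self).symm

theorem chartForm_apply_eq_extend {k : ℕ} (α : DiffForm I M k) (x : M)
    (v : Fin k → TangentSpace I x) {y : E} (hy : y ∈ (extChartAt I x).target) :
    chartForm α x y v = α ((extChartAt I x).symm y)
      (fun i => FiberBundle.extend E (v i) ((extChartAt I x).symm y)) :=
  congrArg (α ((extChartAt I x).symm y)) (funext fun i => chartSymmD_apply_eq_extend x (v i) hy)

/-- Smoothness at `x` of a form: its values on vector fields smooth at `x` are smooth at `x`. -/
def SmoothFormAt {k : ℕ} (α : DiffForm I M k) (x : M) : Prop :=
  ∀ V : Fin k → Π y : M, TangentSpace I y, (∀ i, SmoothField (V i) x) →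
    ContMDiffAt I 𝓘(ℝ, ℝ) ∞ (fun y => α y (fun i => V i y)) x

end Forms

theorem contDiffWithinAt_continuousAlternatingMap {𝕜 E F G : Type*} [NontriviallyNormedField 𝕜]
    [CompleteSpace 𝕜] [NormedAddCommGroup E] [NormedSpace 𝕜 E] [FiniteDimensional 𝕜 E]
    [NormedAddCommGroup F] [NormedSpace 𝕜 F] [NormedAddCommGroup G] [NormedSpace 𝕜 G]
    [FiniteDimensional 𝕜 G] {k : ℕ} {n : ℕ∞ω} {α : F → E [⋀^Fin k]→L[𝕜] G} {s : Set F} {y : F}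
    (h : ∀ v, ContDiffWithinAt 𝕜 n (fun z => α z v) s y) : ContDiffWithinAt 𝕜 n α s y := by
  let b := Module.finBasis 𝕜 E
  let evalBasis : E [⋀^Fin k]→L[𝕜] G →ₗ[𝕜] ((Fin k → Fin (finrank 𝕜 E)) → G) :=
    { toFun := fun f t => f fun i => b (t i)
      map_add' := fun _ _ => rfl
      map_smul' := fun _ _ => rfl }
  have evalBasis_injective : Function.Injective evalBasis := fun f g hfg => by
    have hmulti : f.toMultilinearMap = g.toMultilinearMap :=
      Basis.ext_multilinear (fun _ => b) fun t => congrFun hfg t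
    ext v
    exact DFunLike.congr_fun hmulti v
  obtain ⟨L, hL⟩ :=
    evalBasis.exists_leftInverse_of_injective (LinearMap.ker_eq_bot.2 evalBasis_injective)
  have hcomp : ContDiffWithinAt 𝕜 n (fun z => L.toContinuousLinearMap (evalBasis (α z))) s y :=
    L.toContinuousLinearMap.contDiff.comp_contDiffWithinAt (contDiffWithinAt_pi.2 fun t => h _)
  exact hcomp.congr (fun z _ => (LinearMap.congr_fun hL (α z)).symm)
    (LinearMap.congr_fun hL (α y)).symm

section ExteriorDerivative

variable {E : Type*} [NormedAddCommGroup E] [NormedSpace ℝ E] [FiniteDimensional ℝ E]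
  {H : Type*} [TopologicalSpace H] {I : ModelWithCorners ℝ E H}
  {M : Type*} [TopologicalSpace M] [ChartedSpace H M] [IsManifold I ∞ M] {k : ℕ} {x : M}

theorem SmoothFormAt.contDiffWithinAt_chartForm {α : DiffForm I M k} (hα : SmoothFormAt α x) :
    ContDiffWithinAt ℝ ∞ (chartForm α x) (range I) (extChartAt I x x) := by
  refine contDiffWithinAt_continuousAlternatingMap fun v => ?_
  have hext := hα (fun i => FiberBundle.extend E (v i : TangentSpace I x))
    (fun i => FiberBundle.contMDiffAt_extend I E _)
  refine (contMDiffAt_iff.1 hext).2.congr_of_eventuallyEq ?_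
    (chartForm_apply_eq_extend α x v (mem_extChartAt_target x))
  filter_upwards [extChartAt_target_mem_nhdsWithin x] with y hy
  exact chartForm_apply_eq_extend α x v hy

theorem SmoothFormAt.differentiableWithinAt_chartForm {α : DiffForm I M k}
    (hα : SmoothFormAt α x) :
    DifferentiableWithinAt ℝ (chartForm α x) (range I) (extChartAt I x x) :=
  hα.contDiffWithinAt_chartForm.differentiableWithinAt (by simp)

theorem SmoothFormAt.mdifferentiableAt {α : DiffForm I M k} (hα : SmoothFormAt α x)
    {V : Fin k → Π y : M, TangentSpace I y} (hV : ∀ i, MDiffField (V i) x) :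
    MDifferentiableAt I 𝓘(ℝ, ℝ) (fun y => α y (fun i => V i y)) x := by
  have hchart : DifferentiableWithinAt ℝ (fun y => α ((extChartAt I x).symm y)
      (fun i => V i ((extChartAt I x).symm y))) (range I) (extChartAt I x x) :=
    (hα.differentiableWithinAt_chartForm.continuousAlternatingMap_apply
      fun i => (hV i).differentiableWithinAt_chartField).congr_of_eventuallyEq
      (eventuallyEq_chartForm_chartField α V x).symm
      (chartForm_chartField α V x (mem_extChartAt_target x)).symm
  have := isManifold_one (I := I) (M := M)
  refine mdifferentiableWithinAt_univ.1
    (DifferentiableWithinAt.mdifferentiableWithinAt_of_comp_extChartAt_symm ?_)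
  simp only [preimage_univ, univ_inter]
  exact hchart

theorem minSmoothness_two_le_infty : minSmoothness ℝ 2 ≤ (∞ : ℕ∞ω) := by
  rw [minSmoothness_of_isRCLikeNormedField]
  norm_cast

theorem extDerivWithin_chartForm {α : DiffForm I M k} (hα : ∀ y, SmoothFormAt α y) {y : E}
    (hy : y ∈ (extChartAt I x).target) :
    extDerivWithin (chartForm α x) (range I) y = chartForm (extD α) x y := by
  have := isManifold_one (I := I) (M := M)
  set p := (extChartAt I x).symm y
  set f := extChartAt I p ∘ (extChartAt I x).symm
  have hp : p ∈ (extChartAt I p).source := mem_extChartAt_source p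
  have hy_range := extChartAt_target_subset_range x hy
  have hf : ContDiffWithinAt ℝ ∞ f (range I) y :=
    contDiffWithinAt_ext_coord_change p x ⟨hy, hp⟩
  have hα_diff : DifferentiableWithinAt ℝ (chartForm α p) (range I) (f y) :=
    (hα p).differentiableWithinAt_chartForm
  have hpull : chartForm α x =ᶠ[𝓝[range I] y] fun z =>
      (chartForm α p (f z)).compContinuousLinearMap (fderivWithin ℝ f (range I) z) := by
    filter_upwards [eventually_mem_coordChange_source hy hp] with z hz
    exact chartForm_eq_comp_coordChange α hz.1 hz.2
  rw [hpull.extDerivWithin_eq_of_mem hy_range,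
    extDerivWithin_pullback hα_diff hf minSmoothness_two_le_infty I.uniqueDiffOn
      (I.range_subset_closure_interior hy_range) hy_range (fun z _ => mem_range_self _),
    fderivWithin_coordChange hy hp]
  rfl

theorem extD_extD {α : DiffForm I M k} (hα : ∀ y, SmoothFormAt α y) (x : M) :
    extD (extD α) x = 0 := by
  ext v
  have hd : chartForm (extD α) x =ᶠ[𝓝[range I] (extChartAt I x x)]
      extDerivWithin (chartForm α x) (range I) := by
    filter_upwards [extChartAt_target_mem_nhdsWithin x] with y hy
    exact (extDerivWithin_chartForm hα hy).symm
  rw [extD_eq_extDerivWithin_chartForm, hd.extDerivWithin_eq_of_mem (mem_range_self _),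
    extDerivWithin_extDerivWithin_apply (hα x).contDiffWithinAt_chartForm
      minSmoothness_two_le_infty I.uniqueDiffOn
      (I.range_subset_closure_interior (mem_range_self _)) (mem_range_self _)]
  rfl

theorem SmoothFormAt.extD_apply {α : DiffForm I M (k + 1)} (hα : SmoothFormAt α x)
    {V : Fin (k + 2) → Π y : M, TangentSpace I y} (hV : ∀ i, MDiffField (V i) x) :
    extD α x (fun i => V i x) =
      (∑ i, (-1 : ℝ) ^ i.val * mvfderiv I (fun y => α y (i.removeNth (fun j => V j y))) x (V i x)) -
        ∑ i : Fin (k + 1), ∑ j ≥ i, (-1 : ℝ) ^ (i + j : ℕ) *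
          α x (Matrix.vecCons (VectorField.mlieBracket I (V i.castSucc) (V j.succ) x)
            (j.removeNth <| i.castSucc.removeNth (fun l => V l x))) := by
  have h := extDerivWithin_apply_vectorField hα.differentiableWithinAt_chartForm
    (fun i => (hV i).differentiableWithinAt_chartField) (I.uniqueDiffOn _ (mem_range_self _))
  simp only [chartField_self, ← mlieBracket_eq_lieBracketWithin_chartField, zsmul_eq_mul,
    Int.cast_pow, Int.cast_neg, Int.cast_one] at h
  refine (extD_eq_extDerivWithin_chartForm α x _).trans (h.trans (congrArg₂ (· - ·) ?_ ?_))
  · refine Finset.sum_congr rfl fun i _ => ?_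
    have hderiv := (hα.mdifferentiableAt fun j => hV (i.succAbove j)).mvfderiv
    exact congrArg (fun A : E →L[ℝ] ℝ => (-1 : ℝ) ^ i.val * A (V i x))
      (((eventuallyEq_chartForm_chartField α (fun j => V (i.succAbove j)) x).fderivWithin_eq
        (chartForm_chartField α (fun j => V (i.succAbove j)) x (mem_extChartAt_target x))).trans
        hderiv.symm)
  · exact Finset.sum_congr rfl fun i _ => Finset.sum_congr rfl fun j _ =>
      congrArg (_ * ·) (chartForm_self α x _)

theorem SmoothFormAt.extD {α : DiffForm I M (k + 1)} (hα : ∀ y, SmoothFormAt α y) :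
    SmoothFormAt (extD α) x := by
  intro V hV
  have hformula : (fun y => TorsionGeometry.extD α y (fun i => V i y)) =ᶠ[𝓝 x] fun y =>
      (∑ i, (-1 : ℝ) ^ i.val * mvfderiv I (fun y => α y (i.removeNth (fun j => V j y))) y (V i y)) -
        ∑ i : Fin (k + 1), ∑ j ≥ i, (-1 : ℝ) ^ (i + j : ℕ) *
          α y (Matrix.vecCons (VectorField.mlieBracket I (V i.castSucc) (V j.succ) y)
            (j.removeNth <| i.castSucc.removeNth (fun l => V l y))) := by
    filter_upwards [Filter.eventually_all.2 fun i => (hV i).eventually_mdiff] with y hy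
    exact (hα y).extD_apply hy
  refine ContMDiffAt.congr_of_eventuallyEq (ContMDiffAt.sub (ContMDiffAt.sum fun i _ =>
    contMDiffAt_const.mul (contMDiffAt_mvfderiv (hα x _ fun j => hV (i.succAbove j)) (hV i)))
    (ContMDiffAt.sum fun i _ => ContMDiffAt.sum fun j _ => contMDiffAt_const.mul ?_)) hformula
  have hbracket := hα x (Matrix.vecCons (VectorField.mlieBracket I (V i.castSucc) (V j.succ))
    (j.removeNth <| i.castSucc.removeNth V))
    (Fin.cases ((hV _).mlieBracket (hV _)) fun l => hV _)
  refine hbracket.congr_of_eventuallyEq (Filter.Eventually.of_forall fun y => ?_)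
  exact congrArg (α y) (funext (Fin.cases rfl fun l => rfl))

section LowDegree

variable {X Y Z : Π y : M, TangentSpace I y}

theorem SmoothFormAt.extD_pair {α : DiffForm I M 1} (hα : SmoothFormAt α x)
    (hX : MDiffField X x) (hY : MDiffField Y x) :
    TorsionGeometry.extD α x ![X x, Y x] =
      mvfderiv I (fun y => α y ![Y y]) x (X x) - mvfderiv I (fun y => α y ![X y]) x (Y x)
        - α x ![VectorField.mlieBracket I X Y x] := by
  have sum_derivatives : ∀ f : Fin 2 → ℝ, ∑ i, (-1 : ℝ) ^ i.val * f i = f 0 - f 1 := fun f => by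
    simp [Fin.sum_univ_two, sub_eq_add_neg]
  have sum_brackets : ∀ f : Fin 1 → Fin 1 → ℝ,
      ∑ i : Fin 1, ∑ j ≥ i, (-1 : ℝ) ^ (i + j : ℕ) * f i j = f 0 0 := fun f => by
    simp [show Finset.Ici (0 : Fin 1) = {0} by decide]
  have h := hα.extD_apply (V := ![X, Y]) (Fin.forall_fin_two.2 ⟨hX, hY⟩)
  rw [sum_derivatives, sum_brackets] at h
  refine (congrArg (TorsionGeometry.extD α x) (FinVec.etaExpand_eq _)).trans (h.trans ?_)
  exact congrArg₂ (· - ·)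
    (congrArg₂ (fun f g : M → ℝ => mvfderiv I f x (X x) - mvfderiv I g x (Y x))
      (funext fun y => congrArg (α y) (FinVec.etaExpand_eq _).symm)
      (funext fun y => congrArg (α y) (FinVec.etaExpand_eq _).symm))
    (congrArg (α x) (FinVec.etaExpand_eq _).symm)

theorem SmoothFormAt.extD_triple {α : DiffForm I M 2} (hα : SmoothFormAt α x)
    (hX : MDiffField X x) (hY : MDiffField Y x) (hZ : MDiffField Z x) :
    TorsionGeometry.extD α x ![X x, Y x, Z x] =
      mvfderiv I (fun y => α y ![Y y, Z y]) x (X x) - mvfderiv I (fun y => α y ![X y, Z y]) x (Y x)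
        + mvfderiv I (fun y => α y ![X y, Y y]) x (Z x)
        - α x ![VectorField.mlieBracket I X Y x, Z x] + α x ![VectorField.mlieBracket I X Z x, Y x]
        - α x ![VectorField.mlieBracket I Y Z x, X x] := by
  have sum_derivatives : ∀ f : Fin 3 → ℝ, ∑ i, (-1 : ℝ) ^ i.val * f i = f 0 - f 1 + f 2 :=
    fun f => by simp [Fin.sum_univ_three, sub_eq_add_neg]
  have sum_brackets : ∀ f : Fin 2 → Fin 2 → ℝ,
      ∑ i : Fin 2, ∑ j ≥ i, (-1 : ℝ) ^ (i + j : ℕ) * f i j = f 0 0 - f 0 1 + f 1 1 := fun f => by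
    simp [Fin.sum_univ_two, show Finset.Ici (0 : Fin 2) = {0, 1} by decide,
      show Finset.Ici (1 : Fin 2) = {1} by decide, sub_eq_add_neg]
  have h := hα.extD_apply (V := ![X, Y, Z])
    (Fin.forall_fin_succ.2 ⟨hX, Fin.forall_fin_two.2 ⟨hY, hZ⟩⟩)
  have regroup : ∀ a b c d e f : ℝ, a - b + c - d + e - f = a - b + c - (d - e + f) := by
    intros; ring
  rw [sum_derivatives, sum_brackets] at h
  rw [regroup]
  refine (congrArg (TorsionGeometry.extD α x) (FinVec.etaExpand_eq _)).trans (h.trans ?_)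
  refine congrArg₂ (· - ·) (congrArg₂ (· + ·)
    (congrArg₂ (fun f g : M → ℝ => mvfderiv I f x (X x) - mvfderiv I g x (Y x)) ?_ ?_)
    (congrArg (fun f : M → ℝ => mvfderiv I f x (Z x)) ?_))
    (congrArg₂ (· + ·) (congrArg₂ (· - ·) ?_ ?_) ?_)
  · exact funext fun y => congrArg (α y) (FinVec.etaExpand_eq _).symm
  · exact funext fun y => congrArg (α y) (FinVec.etaExpand_eq _).symm
  · exact funext fun y => congrArg (α y) (FinVec.etaExpand_eq _).symm
  all_goals exact congrArg (α x) (FinVec.etaExpand_eq _).symm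

end LowDegree

end ExteriorDerivative

section Derivation

variable {E : Type*} [NormedAddCommGroup E] [NormedSpace ℝ E]
  {H : Type*} [TopologicalSpace H] {I : ModelWithCorners ℝ E H}
  {M : Type*} [TopologicalSpace M] [ChartedSpace H M] [IsManifold I ∞ M]
  {f : M → ℝ} {V W : Π y : M, TangentSpace I y} {x : M}

theorem mvfderiv_eq_fderivWithin_chartField (W : Π y : M, TangentSpace I y) {z : E}
    (hz : z ∈ (extChartAt I x).target)
    (hf : MDifferentiableAt I 𝓘(ℝ, ℝ) f ((extChartAt I x).symm z)) :
    mvfderiv I f ((extChartAt I x).symm z) (W ((extChartAt I x).symm z))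
      = fderivWithin ℝ (f ∘ (extChartAt I x).symm) (range I) z (chartField W x z) := by
  have := isManifold_one (I := I) (M := M)
  have hchain := mfderiv_comp_mfderivWithin (x := z) hf
    (mdifferentiableWithinAt_extChartAt_symm hz)
    (I.uniqueMDiffOn z (extChartAt_target_subset_range x hz))
  rw [mfderivWithin_eq_fderivWithin] at hchain
  rw [← chartSymmD_chartField W x hz]
  exact (congrArg (fun A : E →L[ℝ] ℝ => A (chartField W x z)) hchain).symm

theorem mvfderiv_clm_comp_extChartAt (l : E →L[ℝ] ℝ) (x : M) (v : TangentSpace I x) :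
    mvfderiv I (fun y => l (extChartAt I x y)) x v = l v := by
  have := isManifold_one (I := I) (M := M)
  have hl : mvfderiv 𝓘(ℝ, E) l (extChartAt I x x) = l := by
    rw [mvfderiv, mfderiv_eq_fderiv, l.fderiv]
    rfl
  refine (mvfderiv_comp_apply (g := l) (f := extChartAt I x) x l.mdifferentiableAt
    (mdifferentiableAt_extChartAt (mem_chart_source H x)) v).trans ?_
  rw [hl]
  exact congrArg (fun A : E →L[ℝ] E => l (A v)) mfderiv_extChartAt_self

theorem eq_of_forall_mvfderiv_eq {u v : TangentSpace I x}
    (h : ∀ f : M → ℝ, ContMDiffAt I 𝓘(ℝ, ℝ) ∞ f x → mvfderiv I f x u = mvfderiv I f x v) :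
    u = v := by
  refine (SeparatingDual.eq_iff_forall_dual_eq (R := ℝ) (V := E)).2 fun l => ?_
  refine (mvfderiv_clm_comp_extChartAt l x u).symm.trans (Eq.trans (h _ ?_)
    (mvfderiv_clm_comp_extChartAt l x v))
  exact l.contMDiff.contMDiffAt.comp x contMDiffAt_extChartAt

variable [CompleteSpace E]

theorem mvfderiv_mvfderiv_apply (hf : ContMDiffAt I 𝓘(ℝ, ℝ) ∞ f x) (hW : SmoothField W x) :
    mvfderiv I (fun y => mvfderiv I f y (W y)) x (V x)
      = fderivWithin ℝ (f ∘ (extChartAt I x).symm) (range I) (extChartAt I x x)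
          (fderivWithin ℝ (chartField W x) (range I) (extChartAt I x x)
            (chartField V x (extChartAt I x x)))
        + fderivWithin ℝ (fderivWithin ℝ (f ∘ (extChartAt I x).symm) (range I)) (range I)
          (extChartAt I x x) (chartField V x (extChartAt I x x))
          (chartField W x (extChartAt I x x)) := by
  have hx : extChartAt I x x ∈ range I := mem_range_self _
  have hF : ContDiffWithinAt ℝ ∞ (f ∘ (extChartAt I x).symm) (range I) (extChartAt I x x) :=
    (contMDiffAt_iff.1 hf).2
  have hF' : DifferentiableWithinAt ℝ (fderivWithin ℝ (f ∘ (extChartAt I x).symm) (range I))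
      (range I) (extChartAt I x x) :=
    (hF.fderivWithin_right (m := ∞) I.uniqueDiffOn (by simp) hx).differentiableWithinAt (by simp)
  have hdiff : ∀ᶠ z in 𝓝[range I] (extChartAt I x x),
      MDifferentiableAt I 𝓘(ℝ, ℝ) f ((extChartAt I x).symm z) := by
    have hcont := continuousAt_extChartAt_symm (I := I) x
    rw [ContinuousAt, extChartAt_to_inv] at hcont
    exact (hcont.mono_left nhdsWithin_le_nhds).eventually (eventually_mdifferentiableAt hf)
  have hchart : (fun z => mvfderiv I f ((extChartAt I x).symm z) (W ((extChartAt I x).symm z)))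
      =ᶠ[𝓝[range I] (extChartAt I x x)]
      fun z => fderivWithin ℝ (f ∘ (extChartAt I x).symm) (range I) z (chartField W x z) := by
    filter_upwards [hdiff, extChartAt_target_mem_nhdsWithin x] with z hfz hz
    exact mvfderiv_eq_fderivWithin_chartField W hz hfz
  have hleibniz := (hchart.fderivWithin_eq (hchart.eq_of_nhdsWithin hx)).trans
    (fderivWithin_clm_apply (I.uniqueDiffOn _ hx) hF' hW.mdiff.differentiableWithinAt_chartField)
  rw [((contMDiffAt_mvfderiv hf hW).mdifferentiableAt (by simp)).mvfderiv, chartField_self V]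
  exact congrArg (fun A : E →L[ℝ] ℝ => A (V x)) hleibniz

theorem mvfderiv_mlieBracket (hf : ContMDiffAt I 𝓘(ℝ, ℝ) ∞ f x) (hV : SmoothField V x)
    (hW : SmoothField W x) :
    mvfderiv I f x (VectorField.mlieBracket I V W x)
      = mvfderiv I (fun y => mvfderiv I f y (W y)) x (V x)
        - mvfderiv I (fun y => mvfderiv I f y (V y)) x (W x) := by
  have hx : extChartAt I x x ∈ range I := mem_range_self _
  have hF : ContDiffWithinAt ℝ ∞ (f ∘ (extChartAt I x).symm) (range I) (extChartAt I x x) :=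
    (contMDiffAt_iff.1 hf).2
  have hsymm := hF.isSymmSndFDerivWithinAt minSmoothness_two_le_infty I.uniqueDiffOn
    (I.range_subset_closure_interior hx) hx
  rw [mvfderiv_mvfderiv_apply hf hW, mvfderiv_mvfderiv_apply hf hV, hsymm.eq,
    add_sub_add_right_eq_sub, (hf.mdifferentiableAt (by simp)).mvfderiv,
    mlieBracket_eq_lieBracketWithin_chartField, VectorField.lieBracketWithin]
  exact map_sub (fderivWithin ℝ (f ∘ (extChartAt I x).symm) (range I) (extChartAt I x x)) _ _

end Derivation

section RelatedFields

variable {E E' : Type*} [NormedAddCommGroup E] [NormedSpace ℝ E] [CompleteSpace E]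
  [NormedAddCommGroup E'] [NormedSpace ℝ E'] [CompleteSpace E']
  {H H' : Type*} [TopologicalSpace H] [TopologicalSpace H']
  {I : ModelWithCorners ℝ E H} {I' : ModelWithCorners ℝ E' H'}
  {M M' : Type*} [TopologicalSpace M] [ChartedSpace H M] [IsManifold I ∞ M]
  [TopologicalSpace M'] [ChartedSpace H' M'] [IsManifold I' ∞ M']
  {p : M → M'} {x : M} {V W : Π y : M, TangentSpace I y} {V' W' : Π z : M', TangentSpace I' z}

theorem mfderiv_mlieBracket_of_related (hp : ContMDiffAt I I' ∞ p x)
    (hV : SmoothField V x) (hW : SmoothField W x)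
    (hV' : SmoothField V' (p x)) (hW' : SmoothField W' (p x))
    (hVV' : ∀ᶠ y in 𝓝 x, mfderiv I I' p y (V y) = V' (p y))
    (hWW' : ∀ᶠ y in 𝓝 x, mfderiv I I' p y (W y) = W' (p y)) :
    mfderiv I I' p x (VectorField.mlieBracket I V W x)
      = VectorField.mlieBracket I' V' W' (p x) := by
  have := isManifold_one (I := I) (M := M)
  have := isManifold_one (I := I') (M := M')
  have hp1 : MDifferentiableAt I I' p x := hp.mdifferentiableAt (by simp)
  have hp_near : ∀ᶠ y in 𝓝 x, MDifferentiableAt I I' p y := by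
    filter_upwards [(contMDiffAt_iff_contMDiffAt_nhds (n := 1) (by simp)).1
      (hp.of_le (by norm_cast))] with y hy
    exact hy.mdifferentiableAt (by simp)
  refine eq_of_forall_mvfderiv_eq fun f hf => ?_
  have hcomp : ∀ {U : Π y : M, TangentSpace I y} {U' : Π z : M', TangentSpace I' z},
      (∀ᶠ y in 𝓝 x, mfderiv I I' p y (U y) = U' (p y)) →
      (fun y => mvfderiv I (f ∘ p) y (U y)) =ᶠ[𝓝 x] (fun z => mvfderiv I' f z (U' z)) ∘ p := by
    intro U U' hUU'
    filter_upwards [hUU', hp_near, hp.continuousAt.eventually (eventually_mdifferentiableAt hf)]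
      with y hy hpy hfy
    rw [mvfderiv_comp_apply y hfy hpy, hy, Function.comp_apply]
  have hdiff : ∀ {U' : Π z : M', TangentSpace I' z}, SmoothField U' (p x) →
      MDifferentiableAt I' 𝓘(ℝ, ℝ) (fun z => mvfderiv I' f z (U' z)) (p x) :=
    fun hU' => (contMDiffAt_mvfderiv hf hU').mdifferentiableAt (by simp)
  rw [← mvfderiv_comp_apply x (hf.mdifferentiableAt (by simp)) hp1,
    mvfderiv_mlieBracket (hf.comp x hp) hV hW, mvfderiv_congr (hcomp hWW'),
    mvfderiv_congr (hcomp hVV'), mvfderiv_comp_apply x (hdiff hW') hp1,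
    mvfderiv_comp_apply x (hdiff hV') hp1, hVV'.self_of_nhds, hWW'.self_of_nhds,
    mvfderiv_mlieBracket hf hV' hW']

end RelatedFields

section Lift

variable {E : Type*} [NormedAddCommGroup E] [NormedSpace ℝ E]
  {H : Type*} [TopologicalSpace H] {I : ModelWithCorners ℝ E H}
  {N : Type*} [TopologicalSpace N] [ChartedSpace H N]

theorem radius_ne_zero {N : Type*} (x : Cone N) : (x.1 : ℝ) ≠ 0 :=
  (show (0 : ℝ) < x.1 from x.1.2).ne'

theorem contMDiff_radius :
    ContMDiff (𝓘(ℝ, ℝ).prod I) 𝓘(ℝ, ℝ) ∞ (fun y : Cone N => (y.1 : ℝ)) :=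
  contMDiff_subtype_val.comp contMDiff_fst

/-- The vector field `f r ∂/∂r + V` on the cone; with this normalization of the radial component,
brackets of lifts are again lifts. -/
def coneLift (f : N → ℝ) (V : Π q : N, TangentSpace I q) :
    Π x : Cone N, TangentSpace (𝓘(ℝ, ℝ).prod I) x :=
  fun x => coneVec I x ((x.1 : ℝ) * f x.2, V x.2)

theorem exists_eq_coneVec_mul (x : Cone N) (u : TangentSpace (𝓘(ℝ, ℝ).prod I) x) :
    ∃ a v, u = coneVec I x ((x.1 : ℝ) * a, v) :=
  ⟨(x.1 : ℝ)⁻¹ * dr I x u, dπ I x u, by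
    rw [mul_inv_cancel_left₀ (radius_ne_zero x), coneVec_dr_dπ]⟩

variable {x : Cone N} {h : N → ℝ}

theorem mvfderiv_radius (u : TangentSpace (𝓘(ℝ, ℝ).prod I) x) :
    mvfderiv (𝓘(ℝ, ℝ).prod I) (fun y : Cone N => (y.1 : ℝ)) x u = dr I x u := rfl

theorem mdifferentiableAt_comp_snd (hh : MDifferentiableAt I 𝓘(ℝ, ℝ) h x.2) :
    MDifferentiableAt (𝓘(ℝ, ℝ).prod I) 𝓘(ℝ, ℝ) (fun y : Cone N => h y.2) x :=
  MDifferentiableAt.comp x hh mdifferentiableAt_snd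

theorem mvfderiv_comp_snd (hh : MDifferentiableAt I 𝓘(ℝ, ℝ) h x.2)
    (u : TangentSpace (𝓘(ℝ, ℝ).prod I) x) :
    mvfderiv (𝓘(ℝ, ℝ).prod I) (fun y : Cone N => h y.2) x u = mvfderiv I h x.2 (dπ I x u) :=
  mvfderiv_comp_apply (f := fun y : Cone N => y.2) x hh mdifferentiableAt_snd u

theorem mvfderiv_radius_mul (hh : MDifferentiableAt I 𝓘(ℝ, ℝ) h x.2)
    (u : TangentSpace (𝓘(ℝ, ℝ).prod I) x) :
    mvfderiv (𝓘(ℝ, ℝ).prod I) (fun y : Cone N => (y.1 : ℝ) * h y.2) x u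
      = (x.1 : ℝ) * mvfderiv I h x.2 (dπ I x u) + h x.2 * dr I x u := by
  rw [mvfderiv_fun_mul (contMDiff_radius.contMDiffAt.mdifferentiableAt (by simp))
    (mdifferentiableAt_comp_snd hh), ← mvfderiv_comp_snd hh]
  rfl

theorem mvfderiv_radius_sq_mul (hh : MDifferentiableAt I 𝓘(ℝ, ℝ) h x.2)
    (u : TangentSpace (𝓘(ℝ, ℝ).prod I) x) :
    mvfderiv (𝓘(ℝ, ℝ).prod I) (fun y : Cone N => (y.1 : ℝ) ^ 2 * h y.2) x u
      = (x.1 : ℝ) ^ 2 * mvfderiv I h x.2 (dπ I x u) + 2 * (x.1 : ℝ) * dr I x u * h x.2 := by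
  have hr : MDifferentiableAt (𝓘(ℝ, ℝ).prod I) 𝓘(ℝ, ℝ) (fun y : Cone N => (y.1 : ℝ)) x :=
    contMDiff_radius.contMDiffAt.mdifferentiableAt (by simp)
  have hproduct := mvfderiv_fun_mul hr (hr.mul (mdifferentiableAt_comp_snd hh))
  have heval : mvfderiv (𝓘(ℝ, ℝ).prod I)
        (fun y : Cone N => (y.1 : ℝ) * ((y.1 : ℝ) * h y.2)) x u
      = (x.1 : ℝ) * mvfderiv (𝓘(ℝ, ℝ).prod I) (fun y : Cone N => (y.1 : ℝ) * h y.2) x u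
        + (x.1 : ℝ) * h x.2 * dr I x u :=
    congrArg (fun A => A u) hproduct
  simp only [sq, mul_assoc]
  rw [heval, mvfderiv_radius_mul hh]
  ring

variable [IsManifold I ∞ N] {f g : N → ℝ} {V W : Π q : N, TangentSpace I q}

theorem smoothField_coneLift (hf : ContMDiffAt I 𝓘(ℝ, ℝ) ∞ f x.2) (hV : SmoothField V x.2) :
    SmoothField (coneLift f V) x := by
  have hf_snd : ContMDiffAt (𝓘(ℝ, ℝ).prod I) 𝓘(ℝ, ℝ) ∞ (fun y : Cone N => f y.2) x :=
    hf.comp x contMDiffAt_snd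
  exact contMDiffAt_coneVec x _ _ (contMDiff_radius.contMDiffAt.mul hf_snd)
    (ContMDiffAt.comp x hV contMDiffAt_snd)

variable [CompleteSpace E]

theorem mlieBracket_coneLift (hf : ContMDiffAt I 𝓘(ℝ, ℝ) ∞ f x.2)
    (hg : ContMDiffAt I 𝓘(ℝ, ℝ) ∞ g x.2) (hV : SmoothField V x.2) (hW : SmoothField W x.2) :
    VectorField.mlieBracket (𝓘(ℝ, ℝ).prod I) (coneLift f V) (coneLift g W) x
      = coneVec I x ((x.1 : ℝ) * (mvfderiv I g x.2 (V x.2) - mvfderiv I f x.2 (W x.2)),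
          VectorField.mlieBracket I V W x.2) := by
  have hfV := smoothField_coneLift hf hV
  have hgW := smoothField_coneLift hg hW
  have hradial : ∀ (k : N → ℝ) (U : Π q : N, TangentSpace I q),
      (fun y : Cone N => mvfderiv (𝓘(ℝ, ℝ).prod I) (fun y : Cone N => (y.1 : ℝ)) y
        (coneLift k U y)) = fun y => (y.1 : ℝ) * k y.2 :=
    fun k U => funext fun y => dr_coneVec y _ _
  have hrelated : ∀ (k : N → ℝ) (U : Π q : N, TangentSpace I q),
      ∀ᶠ y in 𝓝 x, dπ I y (coneLift k U y) = U y.2 :=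
    fun k U => .of_forall fun y => dπ_coneVec y _ _
  rw [← coneVec_dr_dπ x (VectorField.mlieBracket _ _ _ x)]
  congr 2
  · rw [← mvfderiv_radius, mvfderiv_mlieBracket contMDiff_radius.contMDiffAt hfV hgW, hradial,
      hradial, mvfderiv_radius_mul (hg.mdifferentiableAt (by simp)),
      mvfderiv_radius_mul (hf.mdifferentiableAt (by simp))]
    simp only [coneLift, dr_coneVec, dπ_coneVec]
    ring
  · exact mfderiv_mlieBracket_of_related contMDiffAt_snd hfV hgW hV hW (hrelated f V)
      (hrelated g W)

end Lift

section InvertibleHom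

variable {E : Type*} [NormedAddCommGroup E] [NormedSpace ℝ E]
  {H : Type*} [TopologicalSpace H] {I : ModelWithCorners ℝ E H}
  {B : Type*} [TopologicalSpace B] [ChartedSpace H B]
  {F₁ F₂ : Type*} [NormedAddCommGroup F₁] [NormedSpace ℝ F₁] [CompleteSpace F₁]
  [NormedAddCommGroup F₂] [NormedSpace ℝ F₂] {V₁ V₂ : B → Type*}
  [TopologicalSpace (TotalSpace F₁ V₁)] [∀ x, AddCommGroup (V₁ x)] [∀ x, Module ℝ (V₁ x)]
  [∀ x, TopologicalSpace (V₁ x)] [FiberBundle F₁ V₁] [VectorBundle ℝ F₁ V₁]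
  [TopologicalSpace (TotalSpace F₂ V₂)] [∀ x, AddCommGroup (V₂ x)] [∀ x, Module ℝ (V₂ x)]
  [∀ x, TopologicalSpace (V₂ x)] [FiberBundle F₂ V₂] [VectorBundle ℝ F₂ V₂]
  [∀ x, IsTopologicalAddGroup (V₂ x)] [∀ x, ContinuousSMul ℝ (V₂ x)]

theorem contMDiffAt_of_isInvertible_of_clm_apply {A : Π x, V₁ x →L[ℝ] V₂ x} {s : Π x, V₁ x}
    {x₀ : B} (hinv : ∀ x, (A x).IsInvertible)
    (hA : ContMDiffAt I (I.prod 𝓘(ℝ, F₁ →L[ℝ] F₂)) ∞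
      (fun x => TotalSpace.mk' (F₁ →L[ℝ] F₂) (E := fun y => V₁ y →L[ℝ] V₂ y) x (A x)) x₀)
    (hAs : ContMDiffAt I (I.prod 𝓘(ℝ, F₂)) ∞ (fun x => TotalSpace.mk' F₂ x (A x (s x))) x₀) :
    ContMDiffAt I (I.prod 𝓘(ℝ, F₁)) ∞ (fun x => TotalSpace.mk' F₁ x (s x)) x₀ := by
  rw [contMDiffAt_hom_bundle] at hA
  rw [contMDiffAt_totalSpace] at hAs ⊢
  refine ⟨contMDiffAt_id, ?_⟩
  set A' := fun x => ContinuousLinearMap.inCoordinates F₁ V₁ F₂ V₂ x₀ x x₀ x (A x) with hA'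
  have hA'_inv : ∀ x ∈ (trivializationAt F₁ V₁ x₀).baseSet,
      x ∈ (trivializationAt F₂ V₂ x₀).baseSet → (A' x).IsInvertible := by
    intro x hx₁ hx₂
    simp only [hA', ContinuousLinearMap.inCoordinates_eq hx₁ hx₂]
    exact ContinuousLinearMap.isInvertible_equiv.comp
      ((hinv x).comp ContinuousLinearMap.isInvertible_equiv)
  have hA'_apply : ∀ x ∈ (trivializationAt F₁ V₁ x₀).baseSet,
      x ∈ (trivializationAt F₂ V₂ x₀).baseSet →
      A' x (trivializationAt F₁ V₁ x₀ ⟨x, s x⟩).2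
        = (trivializationAt F₂ V₂ x₀ ⟨x, A x (s x)⟩).2 := by
    intro x hx₁ hx₂
    simp [hA', ContinuousLinearMap.inCoordinates_eq hx₁ hx₂, hx₁]
  have hx₁ := FiberBundle.mem_baseSet_trivializationAt' (F := F₁) (E := V₁) x₀
  have hx₂ := FiberBundle.mem_baseSet_trivializationAt' (F := F₂) (E := V₂) x₀
  obtain ⟨e, he⟩ := hA'_inv x₀ hx₁ hx₂
  have hinverse : ContMDiffAt I 𝓘(ℝ, F₂ →L[ℝ] F₁) ∞ (fun x => (A' x).inverse) x₀ :=
    (he ▸ contDiffAt_map_inverse e : ContDiffAt ℝ ∞ _ (A' x₀)).contMDiffAt.comp x₀ hA.2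
  refine (hinverse.clm_apply hAs.2).congr_of_eventuallyEq ?_
  filter_upwards [(trivializationAt F₁ V₁ x₀).open_baseSet.mem_nhds hx₁,
    (trivializationAt F₂ V₂ x₀).open_baseSet.mem_nhds hx₂] with x hx₁ hx₂
  exact ((hA'_inv x hx₁ hx₂).inverse_apply_eq.2 (hA'_apply x hx₁ hx₂).symm).symm

end InvertibleHom

section Metric

variable {E : Type*} [NormedAddCommGroup E] [NormedSpace ℝ E]
  {H : Type*} [TopologicalSpace H] {I : ModelWithCorners ℝ E H}
  {M : Type*} [TopologicalSpace M] [ChartedSpace H M] [IsManifold I ∞ M]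
  (g : RiemMetric I M) {X X' Y Y' : Π y : M, TangentSpace I y} {f : M → ℝ} {x : M}

theorem contMDiffAt_inner (hX : SmoothField X x) (hY : SmoothField Y x) :
    ContMDiffAt I 𝓘(ℝ, ℝ) ∞ (fun y => g.inner y (X y) (Y y)) x := by
  have h := ContMDiffAt.clm_bundle_apply₂ (F₁ := E) (F₂ := E) (F₃ := ℝ)
    (E₃ := Bundle.Trivial M ℝ) (b := fun y : M => y) g.contMDiff.contMDiffAt hX hY
  exact (contMDiffAt_totalSpace.1 h).2

theorem mdifferentiableAt_inner (hX : MDiffField X x) (hY : MDiffField Y x) :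
    MDifferentiableAt I 𝓘(ℝ, ℝ) (fun y => g.inner y (X y) (Y y)) x := by
  have h := MDifferentiableAt.clm_bundle_apply₂ (F₁ := E) (F₂ := E) (F₃ := ℝ)
    (E₃ := Bundle.Trivial M ℝ) (b := fun y : M => y)
    (g.contMDiff.contMDiffAt.mdifferentiableAt (by simp)) hX hY
  exact ((mdifferentiableAt_totalSpace _ _).1 h).2

theorem eq_zero_of_inner_self_eq_zero {a : TangentSpace I x} (h : g.inner x a a = 0) : a = 0 := by
  by_contra ha
  exact (g.pos x a ha).ne' h

theorem eq_of_forall_inner_eq {a b : TangentSpace I x}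
    (h : ∀ Z : Π y : M, TangentSpace I y, SmoothField Z x →
      g.inner x a (Z x) = g.inner x b (Z x)) : a = b := by
  obtain ⟨Z, hZ, hZx⟩ := exists_smoothField_eq (a - b)
  refine sub_eq_zero.1 (eq_zero_of_inner_self_eq_zero g ?_)
  have hab := h Z hZ
  rw [hZx] at hab
  exact (congrArg (fun l : E →L[ℝ] ℝ => l (a - b)) (map_sub (g.inner x) a b)).trans
    (sub_eq_zero.2 hab)

variable {g}

theorem mvfderiv_inner_smul_left (hf : MDifferentiableAt I 𝓘(ℝ, ℝ) f x) (hX : MDiffField X x)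
    (hY : MDiffField Y x) (v : TangentSpace I x) :
    mvfderiv I (fun y => g.inner y ((f • X) y) (Y y)) x v
      = f x * mvfderiv I (fun y => g.inner y (X y) (Y y)) x v
        + g.inner x (X x) (Y x) * mvfderiv I f x v := by
  simp only [Pi.smul_apply', map_smul, smul_apply, smul_eq_mul]
  rw [mvfderiv_fun_mul hf (mdifferentiableAt_inner g hX hY)]
  rfl

theorem mvfderiv_inner_add_left (hX : MDiffField X x) (hX' : MDiffField X' x)
    (hY : MDiffField Y x) (v : TangentSpace I x) :
    mvfderiv I (fun y => g.inner y ((X + X') y) (Y y)) x v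
      = mvfderiv I (fun y => g.inner y (X y) (Y y)) x v
        + mvfderiv I (fun y => g.inner y (X' y) (Y y)) x v := by
  simp only [Pi.add_apply, map_add, add_apply]
  rw [mvfderiv_fun_add (mdifferentiableAt_inner g hX hY) (mdifferentiableAt_inner g hX' hY)]
  rfl

theorem inner_field_comm (X Y : Π y : M, TangentSpace I y) :
    (fun y => g.inner y (X y) (Y y)) = fun y => g.inner y (Y y) (X y) :=
  funext fun y => g.symm y _ _

theorem mvfderiv_inner_smul_right (hf : MDifferentiableAt I 𝓘(ℝ, ℝ) f x) (hX : MDiffField X x)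
    (hY : MDiffField Y x) (v : TangentSpace I x) :
    mvfderiv I (fun y => g.inner y (X y) ((f • Y) y)) x v
      = f x * mvfderiv I (fun y => g.inner y (X y) (Y y)) x v
        + g.inner x (X x) (Y x) * mvfderiv I f x v := by
  rw [inner_field_comm, mvfderiv_inner_smul_left hf hY hX, inner_field_comm, g.symm]

theorem mvfderiv_inner_add_right (hX : MDiffField X x) (hY : MDiffField Y x)
    (hY' : MDiffField Y' x) (v : TangentSpace I x) :
    mvfderiv I (fun y => g.inner y (X y) ((Y + Y') y)) x v
      = mvfderiv I (fun y => g.inner y (X y) (Y y)) x v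
        + mvfderiv I (fun y => g.inner y (X y) (Y' y)) x v := by
  rw [inner_field_comm, mvfderiv_inner_add_left hY hY' hX, inner_field_comm, inner_field_comm Y']

variable (g) [FiniteDimensional ℝ E]

theorem isInvertible_inner (x : M) : (g.inner x).IsInvertible := by
  let flatL : E →L[ℝ] E →L[ℝ] ℝ := g.inner x
  let flat : E →ₗ[ℝ] (E →L[ℝ] ℝ) := flatL
  have hinj : Function.Injective flat := (injective_iff_map_eq_zero flat).2 fun a ha =>
    eq_zero_of_inner_self_eq_zero g (x := x) (congrArg (fun l : E →L[ℝ] ℝ => l a) ha)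
  have hfin : finrank ℝ E = finrank ℝ (E →L[ℝ] ℝ) := by
    rw [← (LinearMap.toContinuousLinearMap (𝕜 := ℝ) (E := E) (F' := ℝ)).finrank_eq,
      Subspace.dual_finrank_eq]
  exact ⟨(LinearEquiv.ofInjectiveOfFinrankEq flat hinj hfin).toContinuousLinearEquiv,
    ContinuousLinearMap.ext fun _ => rfl⟩

/-- The musical isomorphism inverse to `a ↦ g(a, ·)`. -/
def sharp (x : M) : (TangentSpace I x →L[ℝ] ℝ) →L[ℝ] TangentSpace I x :=
  (g.inner x).inverse

theorem inner_sharp (x : M) (a : TangentSpace I x →L[ℝ] ℝ) (v : TangentSpace I x) :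
    g.inner x (sharp g x a) v = a v :=
  congrArg (fun l : E →L[ℝ] ℝ => l v) ((isInvertible_inner g x).self_apply_inverse a)

theorem smoothField_of_forall_contMDiffAt_inner {V : Π y : M, TangentSpace I y}
    (h : ∀ Z : Π y : M, TangentSpace I y, SmoothField Z x →
      ContMDiffAt I 𝓘(ℝ, ℝ) ∞ (fun y => g.inner y (V y) (Z y)) x) :
    SmoothField V x := by
  have hflat := contMDiffAt_hom (I := I) (F₁ := E) (F₂ := ℝ) (V₁ := fun y : M => TangentSpace I y)
    (V₂ := Bundle.Trivial M ℝ) (fun y => g.inner y (V y)) x fun Z hZ =>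
      contMDiffAt_totalSpace.2 ⟨contMDiffAt_id, h Z hZ⟩
  exact contMDiffAt_of_isInvertible_of_clm_apply (isInvertible_inner g)
    g.contMDiff.contMDiffAt hflat

end Metric

section Koszul

variable {E : Type*} [NormedAddCommGroup E] [NormedSpace ℝ E]
  {H : Type*} [TopologicalSpace H] {I : ModelWithCorners ℝ E H}
  {M : Type*} [TopologicalSpace M] [ChartedSpace H M] [IsManifold I ∞ M]

/-- Twice the value of `g(D_X Y, Z)`, as given by the Koszul formula, for the metric connection `D`
whose torsion is the `3`-form `c`. -/
def koszul (g : RiemMetric I M) (c : DiffForm I M 3) (X Y Z : Π y : M, TangentSpace I y) (x : M) :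
    ℝ :=
  mvfderiv I (fun y => g.inner y (Y y) (Z y)) x (X x)
    + mvfderiv I (fun y => g.inner y (X y) (Z y)) x (Y x)
    - mvfderiv I (fun y => g.inner y (X y) (Y y)) x (Z x)
    + g.inner x (VectorField.mlieBracket I X Y x) (Z x)
    - g.inner x (VectorField.mlieBracket I X Z x) (Y x)
    - g.inner x (VectorField.mlieBracket I Y Z x) (X x)
    + c x ![X x, Y x, Z x]

variable {g : RiemMetric I M} {c : DiffForm I M 3} {X X' Y Y' Z Z' : Π y : M, TangentSpace I y}
  {x : M} {f : M → ℝ}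

theorem koszul_add_swap_right (X Y Z : Π y : M, TangentSpace I y) :
    koszul g c X Y Z x + koszul g c X Z Y x
      = 2 * mvfderiv I (fun y => g.inner y (Y y) (Z y)) x (X x) := by
  simp only [koszul]
  rw [inner_field_comm Z Y, VectorField.mlieBracket_swap_apply (V := Z) (W := Y), map_swap_snd_thd]
  simp only [map_neg, neg_apply]
  ring

theorem koszul_sub_swap_left (X Y Z : Π y : M, TangentSpace I y) :
    koszul g c X Y Z x - koszul g c Y X Z x
      = 2 * (g.inner x (VectorField.mlieBracket I X Y x) (Z x) + c x ![X x, Y x, Z x]) := by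
  simp only [koszul]
  rw [inner_field_comm Y X, VectorField.mlieBracket_swap_apply (V := Y) (W := X),
    map_swap_fst_snd (c x) (X x)]
  simp only [map_neg, neg_apply]
  ring

variable [CompleteSpace E]

theorem contMDiffAt_koszul (hc : SmoothFormAt c x) (hX : SmoothField X x)
    (hY : SmoothField Y x) (hZ : SmoothField Z x) :
    ContMDiffAt I 𝓘(ℝ, ℝ) ∞ (koszul g c X Y Z) x := by
  have hcXYZ : ContMDiffAt I 𝓘(ℝ, ℝ) ∞ (fun y => c y ![X y, Y y, Z y]) x := by
    refine (hc ![X, Y, Z] (by simp [Fin.forall_fin_succ, hX, hY, hZ])).congr_of_eventuallyEq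
      (.of_forall fun y => congrArg (c y) (FinVec.etaExpand_eq fun i => ![X, Y, Z] i y))
  exact ((((((contMDiffAt_mvfderiv (contMDiffAt_inner g hY hZ) hX).add
    (contMDiffAt_mvfderiv (contMDiffAt_inner g hX hZ) hY)).sub
    (contMDiffAt_mvfderiv (contMDiffAt_inner g hX hY) hZ)).add
    (contMDiffAt_inner g (hX.mlieBracket hY) hZ)).sub
    (contMDiffAt_inner g (hX.mlieBracket hZ) hY)).sub
    (contMDiffAt_inner g (hY.mlieBracket hZ) hX)).add hcXYZ

theorem koszul_smul_left (hf : MDifferentiableAt I 𝓘(ℝ, ℝ) f x) (hX : MDiffField X x)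
    (hY : MDiffField Y x) (hZ : MDiffField Z x) :
    koszul g c (f • X) Y Z x = f x * koszul g c X Y Z x := by
  simp only [koszul]
  rw [mvfderiv_inner_smul_left hf hX hZ, mvfderiv_inner_smul_left hf hX hY,
    VectorField.mlieBracket_smul_left hf hX, VectorField.mlieBracket_smul_left hf hX]
  simp only [Pi.smul_apply', map_add, map_smul, map_neg, neg_smul, add_apply, smul_apply,
    neg_apply, smul_eq_mul, (c x).vecCons_smul]
  ring

theorem koszul_add_left (hX : MDiffField X x) (hX' : MDiffField X' x)
    (hY : MDiffField Y x) (hZ : MDiffField Z x) :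
    koszul g c (X + X') Y Z x = koszul g c X Y Z x + koszul g c X' Y Z x := by
  simp only [koszul]
  rw [mvfderiv_inner_add_left hX hX' hZ, mvfderiv_inner_add_left hX hX' hY,
    VectorField.mlieBracket_add_left hX hX', VectorField.mlieBracket_add_left hX hX']
  simp only [Pi.add_apply, map_add, add_apply, (c x).vecCons_add]
  ring

theorem koszul_smul_right (hf : MDifferentiableAt I 𝓘(ℝ, ℝ) f x) (hX : MDiffField X x)
    (hY : MDiffField Y x) (hZ : MDiffField Z x) :
    koszul g c X Y (f • Z) x = f x * koszul g c X Y Z x := by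
  simp only [koszul]
  rw [mvfderiv_inner_smul_right hf hX hZ, mvfderiv_inner_smul_right hf hY hZ,
    VectorField.mlieBracket_smul_right hf hZ, VectorField.mlieBracket_smul_right hf hZ]
  simp only [Pi.smul_apply', map_add, map_smul, add_apply, smul_apply, smul_eq_mul, map_thd_smul,
    g.symm x (Z x)]
  ring

theorem koszul_add_right (hX : MDiffField X x) (hY : MDiffField Y x) (hZ : MDiffField Z x)
    (hZ' : MDiffField Z' x) :
    koszul g c X Y (Z + Z') x = koszul g c X Y Z x + koszul g c X Y Z' x := by
  simp only [koszul]
  rw [mvfderiv_inner_add_right hX hZ hZ', mvfderiv_inner_add_right hY hZ hZ',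
    VectorField.mlieBracket_add_right hZ hZ', VectorField.mlieBracket_add_right hZ hZ']
  simp only [Pi.add_apply, map_add, add_apply, map_thd_add]
  ring

theorem koszul_smul_middle (hf : MDifferentiableAt I 𝓘(ℝ, ℝ) f x) (hX : MDiffField X x)
    (hY : MDiffField Y x) (hZ : MDiffField Z x) :
    koszul g c X (f • Y) Z x
      = f x * koszul g c X Y Z x + 2 * mvfderiv I f x (X x) * g.inner x (Y x) (Z x) := by
  simp only [koszul]
  rw [mvfderiv_inner_smul_left hf hY hZ, mvfderiv_inner_smul_right hf hX hY,
    VectorField.mlieBracket_smul_right hf hY, VectorField.mlieBracket_smul_left hf hY]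
  simp only [Pi.smul_apply', map_add, map_smul, map_neg, neg_smul, add_apply, smul_apply,
    neg_apply, smul_eq_mul, map_snd_smul, g.symm x (Y x)]
  ring

theorem koszul_add_middle (hX : MDiffField X x) (hY : MDiffField Y x) (hY' : MDiffField Y' x)
    (hZ : MDiffField Z x) :
    koszul g c X (Y + Y') Z x = koszul g c X Y Z x + koszul g c X Y' Z x := by
  simp only [koszul]
  rw [mvfderiv_inner_add_left hY hY' hZ, mvfderiv_inner_add_right hX hY hY',
    VectorField.mlieBracket_add_left hY hY', VectorField.mlieBracket_add_right hY hY']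
  simp only [Pi.add_apply, map_add, add_apply, map_snd_add]
  ring

theorem tensorialAt_koszul_left (hY : MDiffField Y x) (hZ : MDiffField Z x) :
    TensorialAt I E (fun X => koszul g c X Y Z x) x where
  smul hf hX := koszul_smul_left hf hX hY hZ
  add hX hX' := koszul_add_left hX hX' hY hZ

theorem tensorialAt_koszul_right (hX : MDiffField X x) (hY : MDiffField Y x) :
    TensorialAt I E (fun Z => koszul g c X Y Z x) x where
  smul hf hZ := koszul_smul_right hf hX hY hZ
  add hZ hZ' := koszul_add_right hX hY hZ hZ'

end Koszul

section KoszulConnection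

variable {E : Type*} [NormedAddCommGroup E] [NormedSpace ℝ E] [FiniteDimensional ℝ E]
  {H : Type*} [TopologicalSpace H] {I : ModelWithCorners ℝ E H}
  {M : Type*} [TopologicalSpace M] [ChartedSpace H M] [IsManifold I ∞ M]
  (g : RiemMetric I M) (c : DiffForm I M 3) {X Y Z : Π y : M, TangentSpace I y} {x : M}

open scoped Classical in
/-- The operator `X ↦ D_X Y` at the point `x` determined by the Koszul formula, with the value `0`
if `Y` is not differentiable at `x`. -/
def koszulDeriv (Y : Π y : M, TangentSpace I y) (x : M) :
    TangentSpace I x →L[ℝ] TangentSpace I x :=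
  if hY : MDiffField Y x then
    ((2 : ℝ)⁻¹ • sharp g x).comp (TensorialAt.mkHom₂ (fun X Z => koszul g c X Y Z x) x
      (fun _ hZ => tensorialAt_koszul_left hY hZ) (fun _ hX => tensorialAt_koszul_right hX hY))
  else 0

theorem inner_koszulDeriv (hX : MDiffField X x) (hY : MDiffField Y x) (hZ : MDiffField Z x) :
    g.inner x (koszulDeriv g c Y x (X x)) (Z x) = 2⁻¹ * koszul g c X Y Z x := by
  rw [koszulDeriv, dif_pos hY, ContinuousLinearMap.comp_apply, smul_apply, map_smul, smul_apply,
    inner_sharp, smul_eq_mul]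
  congr 1
  exact TensorialAt.mkHom₂_apply _ _ hX hZ

theorem isCovariantDerivativeOn_koszulDeriv : IsCovariantDerivativeOn E (koszulDeriv g c) where
  add {Y Y' x} hY hY' _ := by
    have hYY' : MDiffField (Y + Y') x := mdifferentiableAt_add_section hY hY'
    ext v
    obtain ⟨X, hX, rfl⟩ := exists_smoothField_eq v
    refine eq_of_forall_inner_eq g fun Z hZ => ?_
    rw [inner_koszulDeriv g c hX.mdiff hYY' hZ.mdiff,
      koszul_add_middle hX.mdiff hY hY' hZ.mdiff, add_apply, map_add, add_apply,
      inner_koszulDeriv g c hX.mdiff hY hZ.mdiff, inner_koszulDeriv g c hX.mdiff hY' hZ.mdiff]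
    ring
  leibniz {Y f x} hY hf _ := by
    have hfY : MDiffField (f • Y) x := hf.smul_section hY
    ext v
    obtain ⟨X, hX, rfl⟩ := exists_smoothField_eq v
    refine eq_of_forall_inner_eq g fun Z hZ => ?_
    rw [inner_koszulDeriv g c hX.mdiff hfY hZ.mdiff,
      koszul_smul_middle hf hX.mdiff hY hZ.mdiff, add_apply, map_add, add_apply, smul_apply,
      map_smul, smul_apply, inner_koszulDeriv g c hX.mdiff hY hZ.mdiff,
      ContinuousLinearMap.smulRight_apply, map_smul, smul_apply]
    simp only [smul_eq_mul]
    ring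

/-- The metric connection whose torsion is the `3`-form `c`. -/
def koszulConnection : CovariantDerivative I E (fun x : M => TangentSpace I x) :=
  ⟨koszulDeriv g c, isCovariantDerivativeOn_koszulDeriv g c⟩

theorem inner_koszulConnection (hX : MDiffField X x) (hY : MDiffField Y x) (hZ : MDiffField Z x) :
    g.inner x (koszulConnection g c Y x (X x)) (Z x) = 2⁻¹ * koszul g c X Y Z x :=
  inner_koszulDeriv g c hX hY hZ

theorem inner_torsion_koszulConnection (x : M) (u v w : TangentSpace I x) :
    g.inner x ((koszulConnection g c).torsion x u v) w = c x ![u, v, w] := by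
  obtain ⟨X, hX, rfl⟩ := exists_smoothField_eq u
  obtain ⟨Y, hY, rfl⟩ := exists_smoothField_eq v
  obtain ⟨Z, hZ, rfl⟩ := exists_smoothField_eq w
  have htorsion := (koszulConnection g c).torsion_apply hX.mdiff hY.mdiff
  rw [htorsion, map_sub, map_sub, sub_apply, sub_apply,
    inner_koszulConnection g c hX.mdiff hY.mdiff hZ.mdiff,
    inner_koszulConnection g c hY.mdiff hX.mdiff hZ.mdiff]
  linarith [koszul_sub_swap_left (g := g) (c := c) (x := x) X Y Z]

theorem mvfderiv_inner_koszulConnection (hY : MDiffField Y x) (hZ : MDiffField Z x)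
    (v : TangentSpace I x) :
    mvfderiv I (fun y => g.inner y (Y y) (Z y)) x v
      = g.inner x (koszulConnection g c Y x v) (Z x)
        + g.inner x (Y x) (koszulConnection g c Z x v) := by
  obtain ⟨X, hX, rfl⟩ := exists_smoothField_eq v
  rw [g.symm x (Y x), inner_koszulConnection g c hX.mdiff hY hZ,
    inner_koszulConnection g c hX.mdiff hZ hY]
  linarith [koszul_add_swap_right (g := g) (c := c) (x := x) X Y Z]

variable {c}

theorem contMDiff_koszulConnection (hc : ∀ x, SmoothFormAt c x) :
    (koszulConnection g c).ContMDiffCovariantDerivative ∞ := by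
  refine ⟨⟨fun {Y} hY x _ => ContMDiffAt.contMDiffWithinAt ?_⟩⟩
  have hY : SmoothField Y x := (hY x (mem_univ x)).contMDiffAt Filter.univ_mem
  refine contMDiffAt_hom (F₁ := E) (F₂ := E) (koszulDeriv g c Y) x fun X hX =>
    smoothField_of_forall_contMDiffAt_inner g fun Z hZ => ?_
  refine ((contMDiffAt_const (c := (2 : ℝ)⁻¹)).mul
    (contMDiffAt_koszul (g := g) (hc x) hX hY hZ)).congr_of_eventuallyEq ?_
  filter_upwards [SmoothField.eventually_mdiff hX, hY.eventually_mdiff, hZ.eventually_mdiff]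
    with y hXy hYy hZy
  exact inner_koszulDeriv g c hXy hYy hZy

end KoszulConnection

section Hermitian

variable {E : Type*} [NormedAddCommGroup E] [NormedSpace ℝ E]
  {H : Type*} [TopologicalSpace H] {I : ModelWithCorners ℝ E H}
  {M : Type*} [TopologicalSpace M] [ChartedSpace H M] [IsManifold I ∞ M]

namespace AlmostHermitian

variable (A : AlmostHermitian I M)

theorem inner_J_right (x : M) (a b : TangentSpace I x) :
    A.g.inner x a (A.J x b) = -A.g.inner x (A.J x a) b := by
  rw [← A.compat x a, A.J_J, map_neg]

theorem smoothFormAt_fundForm (x : M) : SmoothFormAt A.fundForm x := fun _ hV =>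
  contMDiffAt_inner A.g (SmoothField.endo A.smooth_J (hV 0)) (hV 1)

/-- The `3`-form `dω(J ·, J ·, J ·)` of a Hermitian structure with fundamental form `ω`, which is
the torsion of its Bismut connection. -/
def bismutForm : DiffForm I M 3 := fun x => (extD A.fundForm x).compContinuousLinearMap (A.J x)

theorem bismutForm_apply (x : M) (a b c : TangentSpace I x) :
    A.bismutForm x ![a, b, c] = extD A.fundForm x ![A.J x a, A.J x b, A.J x c] :=
  congrArg (extD A.fundForm x) (FinVec.etaExpand_eq fun i => A.J x (![a, b, c] i)).symm

variable [FiniteDimensional ℝ E]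

theorem smoothFormAt_bismutForm (x : M) : SmoothFormAt A.bismutForm x := fun V hV =>
  SmoothFormAt.extD A.smoothFormAt_fundForm (fun i y => A.J y (V i y))
    fun i => SmoothField.endo A.smooth_J (hV i)

variable {A} {X Y Z : Π y : M, TangentSpace I y} {x : M}

theorem extD_fundForm (hX : MDiffField X x) (hY : MDiffField Y x) (hZ : MDiffField Z x) :
    extD A.fundForm x ![X x, Y x, Z x] =
      mvfderiv I (fun y => A.g.inner y (A.J y (Y y)) (Z y)) x (X x)
        - mvfderiv I (fun y => A.g.inner y (A.J y (X y)) (Z y)) x (Y x)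
        + mvfderiv I (fun y => A.g.inner y (A.J y (X y)) (Y y)) x (Z x)
        - A.g.inner x (A.J x (VectorField.mlieBracket I X Y x)) (Z x)
        + A.g.inner x (A.J x (VectorField.mlieBracket I X Z x)) (Y x)
        - A.g.inner x (A.J x (VectorField.mlieBracket I Y Z x)) (X x) :=
  (A.smoothFormAt_fundForm x).extD_triple hX hY hZ

theorem IsIntegrable.koszul_bismutForm_J_add (hA : A.IsIntegrable) (hX : MDiffField X x)
    (hY : MDiffField Y x) (hZ : MDiffField Z x) :
    koszul A.g A.bismutForm X (fun y => A.J y (Y y)) Z x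
      + koszul A.g A.bismutForm X Y (fun y => A.J y (Z y)) x = 0 := by
  have hJX := hX.endo A.smooth_J
  have torsion_JY : A.bismutForm x ![X x, A.J x (Y x), Z x]
      = -extD A.fundForm x ![A.J x (X x), Y x, A.J x (Z x)] := by
    rw [bismutForm_apply, A.J_J, map_snd_neg]
  have torsion_JZ : A.bismutForm x ![X x, Y x, A.J x (Z x)]
      = -extD A.fundForm x ![A.J x (X x), A.J x (Y x), Z x] := by
    rw [bismutForm_apply, A.J_J, map_thd_neg]
  have nijenhuis_XY := congrArg (fun v => A.g.inner x (A.J x v) (Z x)) (hA x X Y hX hY)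
  have nijenhuis_XZ := congrArg (fun v => A.g.inner x (A.J x v) (Y x)) (hA x X Z hX hZ)
  simp only [koszul]
  rw [torsion_JY, torsion_JZ, extD_fundForm hJX hY (hZ.endo A.smooth_J),
    extD_fundForm hJX (hY.endo A.smooth_J) hZ]
  simp only [mvfderiv_fun_neg, neg_apply, A.inner_J_right, A.J_J, map_neg, map_sub,
    sub_apply, map_zero, zero_apply] at nijenhuis_XY nijenhuis_XZ ⊢
  linarith

theorem IsIntegrable.isKTConnection_koszulConnection (hA : A.IsIntegrable) :
    A.IsKTConnection (koszulConnection A.g A.bismutForm) A.bismutForm where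
  smooth := contMDiff_koszulConnection A.g A.smoothFormAt_bismutForm
  metric _ _ _ v hY hZ := mvfderiv_inner_koszulConnection A.g A.bismutForm hY hZ v
  torsion := inner_torsion_koszulConnection A.g A.bismutForm
  parallel x Y v hY := by
    obtain ⟨X, hX, rfl⟩ := exists_smoothField_eq v
    refine eq_of_forall_inner_eq A.g fun Z hZ => ?_
    rw [inner_koszulConnection A.g _ hX.mdiff (MDiffField.endo A.smooth_J hY) hZ.mdiff,
      ← neg_neg (A.g.inner x (A.J x _) _), ← A.inner_J_right,
      inner_koszulConnection A.g _ hX.mdiff hY (hZ.mdiff.endo A.smooth_J)]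
    linarith [hA.koszul_bismutForm_J_add hX.mdiff hY hZ.mdiff]

namespace IsKTConnection

variable {D : CovariantDerivative I E (fun x : M => TangentSpace I x)} {c : DiffForm I M 3}

theorem torsion_apply (hD : A.IsKTConnection D c) (hX : MDiffField X x) (hY : MDiffField Y x)
    (w : TangentSpace I x) :
    c x ![X x, Y x, w] = A.g.inner x (D Y x (X x)) w - A.g.inner x (D X x (Y x)) w
      - A.g.inner x (VectorField.mlieBracket I X Y x) w := by
  rw [← hD.torsion, D.torsion_apply hX hY]
  simp only [map_sub, sub_apply]

theorem extD_fundForm (hD : A.IsKTConnection D c) (x : M) (u v w : TangentSpace I x) :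
    extD A.fundForm x ![u, v, w]
      = -c x ![u, v, A.J x w] - c x ![v, w, A.J x u] - c x ![w, u, A.J x v] := by
  obtain ⟨X, hX, rfl⟩ := exists_smoothField_eq u
  obtain ⟨Y, hY, rfl⟩ := exists_smoothField_eq v
  obtain ⟨Z, hZ, rfl⟩ := exists_smoothField_eq w
  have mvfderiv_fundForm : ∀ {V W : Π y : M, TangentSpace I y} (a : TangentSpace I x),
      MDiffField V x → MDiffField W x → mvfderiv I (fun y => A.g.inner y (A.J y (V y)) (W y)) x a
        = A.g.inner x (A.J x (D V x a)) (W x) - A.g.inner x (A.J x (D W x a)) (V x) :=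
    fun {V W} a hV hW => by
      rw [hD.metric x _ W a (hV.endo A.smooth_J) hW, hD.parallel x V a hV,
        A.g.symm x (A.J x (V x)), A.inner_J_right, sub_eq_add_neg]
  rw [AlmostHermitian.extD_fundForm hX.mdiff hY.mdiff hZ.mdiff,
    mvfderiv_fundForm _ hY.mdiff hZ.mdiff, mvfderiv_fundForm _ hX.mdiff hZ.mdiff,
    mvfderiv_fundForm _ hX.mdiff hY.mdiff, hD.torsion_apply hX.mdiff hY.mdiff,
    hD.torsion_apply hY.mdiff hZ.mdiff, hD.torsion_apply hZ.mdiff hX.mdiff,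
    VectorField.mlieBracket_swap_apply (V := Z) (W := X)]
  simp only [A.inner_J_right, map_neg, neg_apply]
  ring

theorem torsion_eq_sum_J_J (hD : A.IsKTConnection D c) (hA : A.IsIntegrable) (x : M)
    (u v w : TangentSpace I x) :
    c x ![u, v, w]
      = c x ![A.J x u, A.J x v, w] + c x ![A.J x u, v, A.J x w] + c x ![u, A.J x v, A.J x w] := by
  obtain ⟨X, hX, rfl⟩ := exists_smoothField_eq u
  obtain ⟨Y, hY, rfl⟩ := exists_smoothField_eq v
  replace hX := hX.mdiff
  replace hY := hY.mdiff
  have hJX := hX.endo A.smooth_J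
  have hJY := hY.endo A.smooth_J
  have nijenhuis := congrArg (fun v => A.g.inner x v w) (hA x X Y hX hY)
  have torsion_JX_JY := hD.torsion_apply hJX hJY w
  have torsion_JX_Y := hD.torsion_apply hJX hY (A.J x w)
  have torsion_X_JY := hD.torsion_apply hX hJY (A.J x w)
  rw [hD.parallel x X _ hX, hD.parallel x Y _ hY] at torsion_JX_JY
  rw [hD.parallel x X _ hX] at torsion_JX_Y
  rw [hD.parallel x Y _ hY] at torsion_X_JY
  simp only [A.inner_J_right, A.J_J, map_neg, map_sub, sub_apply, neg_apply, map_zero,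
    zero_apply] at nijenhuis torsion_JX_JY torsion_JX_Y torsion_X_JY
  linarith [hD.torsion_apply hX hY w]

theorem eq_bismutForm (hD : A.IsKTConnection D c) (hA : A.IsIntegrable) : c = A.bismutForm := by
  funext x
  ext v
  rw [← FinVec.etaExpand_eq v]
  change c x ![v 0, v 1, v 2] = A.bismutForm x ![v 0, v 1, v 2]
  rw [bismutForm_apply, hD.extD_fundForm]
  simp only [A.J_J, map_thd_neg]
  rw [map_rotate (c x) (v 0), ← map_rotate (c x) (A.J x (v 2)),
    hD.torsion_eq_sum_J_J hA]
  ring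

end IsKTConnection

theorem isKTWithTorsion_iff {c : DiffForm I M 3} :
    A.IsKTWithTorsion c ↔ A.IsIntegrable ∧ c = A.bismutForm := by
  constructor
  · rintro ⟨hA, D, hD⟩
    exact ⟨hA, hD.eq_bismutForm hA⟩
  · rintro ⟨hA, rfl⟩
    exact ⟨hA, _, hA.isKTConnection_koszulConnection⟩

theorem isSKT_iff : A.IsSKT ↔ A.IsIntegrable ∧ ∀ x, extD A.bismutForm x = 0 := by
  simp only [IsSKT, isKTWithTorsion_iff, and_assoc]
  exact ⟨fun ⟨_, hA, hc, hclosed⟩ => ⟨hA, hc ▸ hclosed⟩, fun ⟨hA, h⟩ => ⟨_, hA, rfl, h⟩⟩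

end AlmostHermitian

end Hermitian

section Contact

variable {E : Type*} [NormedAddCommGroup E] [NormedSpace ℝ E]
  {H : Type*} [TopologicalSpace H] {I : ModelWithCorners ℝ E H}
  {M : Type*} [TopologicalSpace M] [ChartedSpace H M] [IsManifold I ∞ M]

namespace AlmostContactMetric

variable (S : AlmostContactMetric I M)

theorem smoothField_ξ (x : M) : SmoothField S.ξ x := S.smooth_ξ.contMDiffAt

theorem contMDiffAt_η {V : Π y : M, TangentSpace I y} {x : M} (hV : SmoothField V x) :
    ContMDiffAt I 𝓘(ℝ, ℝ) ∞ (fun y => S.η y (V y)) x :=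
  contMDiffAt_inner S.g (S.smoothField_ξ x) hV

theorem smoothFormAt_η (x : M) : SmoothFormAt (fun y => oneForm (S.η y)) x :=
  fun _ hV => S.contMDiffAt_η (hV 0)

theorem smoothFormAt_F (x : M) : SmoothFormAt S.F x := fun _ hV =>
  contMDiffAt_inner S.g (SmoothField.endo S.smooth_φ (hV 0)) (hV 1)

theorem F_apply (x : M) (a b : TangentSpace I x) : S.F x ![a, b] = S.g.inner x (S.φ x a) b := rfl

theorem φ_φ_eq (x : M) (a : TangentSpace I x) : S.φ x (S.φ x a) = -a + S.η x a • S.ξ x :=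
  S.φ_φ x a

theorem eq_of_φ_eq_of_η_eq {x : M} {a b : TangentSpace I x} (hφ : S.φ x a = S.φ x b)
    (hη : S.η x a = S.η x b) : a = b := by
  have h := congrArg (S.φ x) hφ
  rwa [φ_φ_eq, φ_φ_eq, hη, add_left_inj, neg_inj] at h

theorem inner_φ_right (x : M) (a b : TangentSpace I x) :
    S.g.inner x a (S.φ x b) = -S.g.inner x (S.φ x a) b := by
  have hab := S.inner_φ_self x (a + b)
  simp only [map_add, add_apply, S.inner_φ_self] at hab
  rw [S.g.symm x a]
  linarith

theorem F_ξ_left (x : M) (a : TangentSpace I x) : S.F x ![S.ξ x, a] = 0 := by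
  rw [F_apply, S.φ_ξ, map_zero, zero_apply]

theorem F_ξ_right (x : M) (a : TangentSpace I x) : S.F x ![a, S.ξ x] = 0 := by
  rw [map_swap_fst_snd, F_ξ_left, neg_zero]

theorem F_φ_φ (x : M) (a b : TangentSpace I x) : S.F x ![S.φ x a, S.φ x b] = S.F x ![a, b] := by
  rw [F_apply, inner_φ_right, φ_φ_eq, S.η_φ, zero_smul, add_zero, map_neg, neg_apply, neg_neg,
    F_apply]

theorem mvfderiv_η_ξ_eq_zero (x : M) : mvfderiv I (fun y => S.η y (S.ξ y)) x = 0 := by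
  simp only [S.η_ξ, mvfderiv_const]

theorem mvfderiv_η_φ (X : Π y : M, TangentSpace I y) (x : M) :
    mvfderiv I (fun y => S.η y (S.φ y (X y))) x = 0 := by
  simp only [S.η_φ, mvfderiv_const]

variable [FiniteDimensional ℝ E] {X Y : Π y : M, TangentSpace I y} {x : M}

theorem dη_apply (hX : MDiffField X x) (hY : MDiffField Y x) :
    S.dη x ![X x, Y x] = mvfderiv I (fun y => S.η y (Y y)) x (X x)
      - mvfderiv I (fun y => S.η y (X y)) x (Y x) - S.η x (VectorField.mlieBracket I X Y x) :=
  (S.smoothFormAt_η x).extD_pair hX hY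

variable {S}

theorem IsKilling.dη_ξ_left (hK : S.IsKilling) (x : M) (v : TangentSpace I x) :
    S.dη x ![S.ξ x, v] = 0 := by
  obtain ⟨V, hV, rfl⟩ := exists_smoothField_eq v
  have hξ := (S.smoothField_ξ x).mdiff
  have hkilling := hK x S.ξ V hξ hV.mdiff
  rw [VectorField.mlieBracket_self, Pi.zero_apply, map_zero, zero_apply, zero_add] at hkilling
  rw [S.dη_apply hξ hV.mdiff, mvfderiv_η_ξ_eq_zero, zero_apply, sub_zero]
  exact sub_eq_zero.2 hkilling

theorem IsKilling.mvfderiv_η_ξ (hK : S.IsKilling) (hX : MDiffField X x) :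
    mvfderiv I (fun y => S.η y (X y)) x (S.ξ x) = S.η x (VectorField.mlieBracket I S.ξ X x) := by
  have h := hK.dη_ξ_left x (X x)
  rwa [S.dη_apply (S.smoothField_ξ x).mdiff hX, S.mvfderiv_η_ξ_eq_zero, zero_apply,
    sub_zero, sub_eq_zero] at h

theorem IsKilling.η_mlieBracket_φ_ξ (hK : S.IsKilling) (hX : MDiffField X x) :
    S.η x (VectorField.mlieBracket I (fun y => S.φ y (X y)) S.ξ x) = 0 := by
  have h := hK.dη_ξ_left x (S.φ x (X x))
  rwa [map_swap_fst_snd, S.dη_apply (hX.endo S.smooth_φ) (S.smoothField_ξ x).mdiff,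
    mvfderiv_η_ξ_eq_zero, mvfderiv_η_φ, zero_apply, zero_apply, sub_self, zero_sub, neg_neg] at h

theorem IsST.φ_mlieBracket_φ_ξ (hS : S.IsST) (hX : MDiffField X x) :
    S.φ x (VectorField.mlieBracket I (fun y => S.φ y (X y)) S.ξ x)
      = S.φ x (S.φ x (VectorField.mlieBracket I X S.ξ x)) := by
  have mlieBracket_φ_ξ_right : ∀ Z : Π y : M, TangentSpace I y,
      VectorField.mlieBracket I Z (fun y => S.φ y (S.ξ y)) x = 0 := fun Z => by
    simp only [S.φ_ξ]
    exact congrFun VectorField.mlieBracket_zero_right x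
  have hnormal := hS.1 x X S.ξ hX (S.smoothField_ξ x).mdiff
  rw [mlieBracket_φ_ξ_right, mlieBracket_φ_ξ_right, map_zero, map_swap_fst_snd, hS.2.dη_ξ_left,
    neg_zero, zero_smul, add_zero, sub_zero, zero_add, sub_eq_zero] at hnormal
  exact hnormal.symm

theorem IsST.mlieBracket_φ_ξ (hS : S.IsST) (hX : MDiffField X x) :
    VectorField.mlieBracket I (fun y => S.φ y (X y)) S.ξ x
      = S.φ x (VectorField.mlieBracket I X S.ξ x) :=
  S.eq_of_φ_eq_of_η_eq (hS.φ_mlieBracket_φ_ξ hX) <| by rw [hS.2.η_mlieBracket_φ_ξ hX, S.η_φ]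

theorem IsST.mlieBracket_ξ_φ (hS : S.IsST) (hX : MDiffField X x) :
    VectorField.mlieBracket I S.ξ (fun y => S.φ y (X y)) x
      = S.φ x (VectorField.mlieBracket I S.ξ X x) := by
  rw [VectorField.mlieBracket_swap_apply, hS.mlieBracket_φ_ξ hX,
    VectorField.mlieBracket_swap_apply (V := S.ξ) (W := X), map_neg]

theorem IsNormal.dη_φ_φ (hN : S.IsNormal) (x : M) (u v : TangentSpace I x) :
    S.dη x ![S.φ x u, S.φ x v] = S.dη x ![u, v] := by
  obtain ⟨U, hU, rfl⟩ := exists_smoothField_eq u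
  obtain ⟨V, hV, rfl⟩ := exists_smoothField_eq v
  have hnormal := congrArg (S.η x) (hN x U V hU.mdiff hV.mdiff)
  simp only [map_add, map_sub, map_smul, S.η_φ, S.η_ξ, smul_eq_mul, mul_one, map_zero] at hnormal
  rw [S.dη_apply (hU.endo S.smooth_φ).mdiff (hV.endo S.smooth_φ).mdiff, mvfderiv_η_φ, mvfderiv_η_φ,
    zero_apply, zero_apply]
  linarith

theorem IsST.dη_φ_left (hS : S.IsST) (x : M) (u v : TangentSpace I x) :
    S.dη x ![S.φ x u, v] = -S.dη x ![u, S.φ x v] := by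
  have h := hS.1.dη_φ_φ x u (S.φ x v)
  rw [φ_φ_eq, map_snd_add, map_snd_smul, map_snd_neg, map_swap_fst_snd _ (S.ξ x),
    hS.2.dη_ξ_left, neg_zero, smul_zero, add_zero] at h
  rw [← h, neg_neg]

theorem IsST.dF_ξ_left (hS : S.IsST) (x : M) (u v : TangentSpace I x) :
    extD S.F x ![S.ξ x, u, v] = 0 := by
  obtain ⟨U, hU, rfl⟩ := exists_smoothField_eq u
  obtain ⟨V, hV, rfl⟩ := exists_smoothField_eq v
  have hkilling := hS.2 x _ V (hU.endo S.smooth_φ).mdiff hV.mdiff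
  rw [(S.smoothFormAt_F x).extD_triple (S.smoothField_ξ x).mdiff hU.mdiff hV.mdiff]
  simp only [F_ξ_left, F_ξ_right, mvfderiv_const, zero_apply]
  simp only [F_apply]
  rw [hkilling, hS.mlieBracket_ξ_φ hU.mdiff, S.g.symm x (S.φ x (U x)), S.inner_φ_right]
  ring

end AlmostContactMetric

end Contact

section Nijenhuis

variable {E : Type*} [NormedAddCommGroup E] [NormedSpace ℝ E]
  {H : Type*} [TopologicalSpace H] {I : ModelWithCorners ℝ E H}
  {M : Type*} [TopologicalSpace M] [ChartedSpace H M] [IsManifold I ∞ M]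

namespace AlmostHermitian

variable (A : AlmostHermitian I M)

/-- The Nijenhuis tensor of `J`, whose vanishing is `AlmostHermitian.IsIntegrable`. -/
def nijenhuis (X Y : Π y : M, TangentSpace I y) (x : M) : TangentSpace I x :=
  VectorField.mlieBracket I (fun y => A.J y (X y)) (fun y => A.J y (Y y)) x
    - VectorField.mlieBracket I X Y x
    - A.J x (VectorField.mlieBracket I (fun y => A.J y (X y)) Y x)
    - A.J x (VectorField.mlieBracket I X (fun y => A.J y (Y y)) x)

theorem nijenhuis_swap (X Y : Π y : M, TangentSpace I y) (x : M) :
    A.nijenhuis Y X x = -A.nijenhuis X Y x := by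
  simp only [nijenhuis]
  rw [VectorField.mlieBracket_swap_apply, VectorField.mlieBracket_swap_apply (V := Y),
    VectorField.mlieBracket_swap_apply (V := Y) (W := fun y => A.J y (X y)),
    VectorField.mlieBracket_swap_apply (V := fun y => A.J y (Y y)), map_neg, map_neg]
  abel

theorem nijenhuis_self (X : Π y : M, TangentSpace I y) (x : M) : A.nijenhuis X X x = 0 := by
  rw [nijenhuis, VectorField.mlieBracket_self, VectorField.mlieBracket_self,
    VectorField.mlieBracket_swap_apply (V := X), map_neg]
  simp

variable [FiniteDimensional ℝ E]

theorem tensorialAt_nijenhuis_left (Y : Π y : M, TangentSpace I y) (x : M) :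
    TensorialAt I E (fun X => A.nijenhuis X Y x) x where
  smul {f X} hf hX := by
    have J_smul : (fun y => A.J y ((f • X) y)) = f • fun y => A.J y (X y) :=
      funext fun y => map_smul (A.J y) (f y) (X y)
    have bracket_smul := fun Z => VectorField.mlieBracket_smul_left (I := I) (W := Z) hf hX
    have bracket_smul_J := fun Z => VectorField.mlieBracket_smul_left (I := I) (W := Z) hf
      (MDiffField.endo A.smooth_J hX)
    simp only [nijenhuis]
    rw [J_smul, bracket_smul, bracket_smul, bracket_smul_J, bracket_smul_J]
    simp only [map_add, map_smul, A.J_J]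
    module
  add {X X'} hX hX' := by
    have J_add : (fun y => A.J y ((X + X') y)) = (fun y => A.J y (X y)) + fun y => A.J y (X' y) :=
      funext fun y => map_add (A.J y) (X y) (X' y)
    have bracket_add := fun Z => VectorField.mlieBracket_add_left (I := I) (W := Z) hX hX'
    have bracket_add_J := fun Z => VectorField.mlieBracket_add_left (I := I) (W := Z)
      (MDiffField.endo A.smooth_J hX) (MDiffField.endo A.smooth_J hX')
    simp only [nijenhuis]
    rw [J_add, bracket_add, bracket_add, bracket_add_J, bracket_add_J]
    simp only [map_add]
    abel

theorem tensorialAt_nijenhuis_right (X : Π y : M, TangentSpace I y) (x : M) :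
    TensorialAt I E (fun Y => A.nijenhuis X Y x) x where
  smul hf hY := by
    rw [A.nijenhuis_swap _ X, A.nijenhuis_swap _ X,
      (A.tensorialAt_nijenhuis_left X x).smul hf hY, smul_neg]
  add hY hY' := by
    rw [A.nijenhuis_swap _ X, A.nijenhuis_swap _ X, A.nijenhuis_swap _ X,
      (A.tensorialAt_nijenhuis_left X x).add hY hY', neg_add]

end AlmostHermitian

end Nijenhuis

section Euler

variable {E : Type*} [NormedAddCommGroup E] [NormedSpace ℝ E]
  {H : Type*} [TopologicalSpace H] {I : ModelWithCorners ℝ E H}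
  {N : Type*} [TopologicalSpace N] [ChartedSpace H N]

variable (I N) in
/-- The Euler vector field `r ∂/∂r` of the cone. -/
def coneEuler : Π x : Cone N, TangentSpace (𝓘(ℝ, ℝ).prod I) x := coneLift (fun _ => 1) 0

theorem coneLift_const_eq (a : ℝ) (V : Π q : N, TangentSpace I q) :
    coneLift (fun _ => a) V = (fun _ : Cone N => a) • coneEuler I N + coneLift (fun _ => 0) V := by
  funext x
  simp only [coneEuler, coneLift, Pi.add_apply, Pi.smul_apply', Pi.zero_apply]
  rw [← map_smul, ← map_add]
  simp [mul_comm]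

variable [IsManifold I ∞ N]

theorem smoothField_coneEuler (x : Cone N) : SmoothField (coneEuler I N) x :=
  smoothField_coneLift contMDiffAt_const (contMDiffAt_zeroSection ℝ _)

theorem mlieBracket_coneEuler_coneLift [CompleteSpace E] {f : N → ℝ} {V : Π q : N, TangentSpace I q}
    {x : Cone N} (hf : ContMDiffAt I 𝓘(ℝ, ℝ) ∞ f x.2) (hV : SmoothField V x.2) :
    VectorField.mlieBracket (𝓘(ℝ, ℝ).prod I) (coneEuler I N) (coneLift f V) x = 0 := by
  have bracket_zero : VectorField.mlieBracket I 0 V x.2 = 0 :=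
    congrFun VectorField.mlieBracket_zero_left x.2
  rw [coneEuler, mlieBracket_coneLift (V := 0) contMDiffAt_const hf (contMDiffAt_zeroSection ℝ _)
    hV, bracket_zero, mvfderiv_const, Pi.zero_apply, map_zero, zero_apply, sub_zero, mul_zero,
    Prod.mk_zero_zero, map_zero]

end Euler

section ConeIntegrability

variable {E : Type*} [NormedAddCommGroup E] [NormedSpace ℝ E]
  {H : Type*} [TopologicalSpace H] {I : ModelWithCorners ℝ E H}
  {N : Type*} [TopologicalSpace N] [ChartedSpace H N] [IsManifold I ∞ N]

namespace AlmostContactMetric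

variable (S : AlmostContactMetric I N)

theorem coneJ_coneVec (x : Cone N) (a : ℝ) (v : TangentSpace I x.2) :
    S.coneJ x (coneVec I x ((x.1 : ℝ) * a, v))
      = coneVec I x ((x.1 : ℝ) * -S.η x.2 v, S.φ x.2 v + a • S.ξ x.2) := by
  rw [coneJ_apply, dπ_coneVec, dr_coneVec, inv_mul_cancel_left₀ (radius_ne_zero x), neg_mul,
    mul_neg]

theorem coneJ_coneLift_zero_left (V : Π q : N, TangentSpace I q) :
    (fun x => S.coneJ x (coneLift (fun _ => 0) V x))
      = coneLift (fun q => -S.η q (V q)) (fun q => S.φ q (V q)) :=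
  funext fun x => (S.coneJ_coneVec x 0 (V x.2)).trans (by rw [zero_smul, add_zero]; rfl)

theorem coneJ_coneEuler :
    (fun x => S.coneJ x (coneEuler I N x)) = coneLift (fun _ => 0) S.ξ :=
  funext fun x => (S.coneJ_coneVec x 1 0).trans (by
    rw [map_zero, map_zero, neg_zero, one_smul, zero_add]; rfl)

variable [FiniteDimensional ℝ E] {S} {x : Cone N} {V W : Π q : N, TangentSpace I q}

theorem IsST.nijenhuis_coneEuler (hS : S.IsST) (hV : SmoothField V x.2) :
    S.cone.nijenhuis (coneEuler I N) (coneLift (fun _ => 0) V) x = 0 := by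
  have hφV := hV.endo S.smooth_φ
  have hηV := (S.contMDiffAt_η hV).neg
  have cone_J : S.cone.J = S.coneJ := rfl
  simp only [AlmostHermitian.nijenhuis, cone_J]
  rw [coneJ_coneEuler, coneJ_coneLift_zero_left, mlieBracket_coneEuler_coneLift hηV hφV,
    mlieBracket_coneEuler_coneLift contMDiffAt_const hV,
    mlieBracket_coneLift contMDiffAt_const hηV (S.smoothField_ξ x.2) hφV,
    mlieBracket_coneLift contMDiffAt_const contMDiffAt_const (S.smoothField_ξ x.2) hV,
    coneJ_coneVec, hS.mlieBracket_ξ_φ hV.mdiff]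
  simp only [mvfderiv_fun_neg, mvfderiv_const, neg_apply, zero_apply, hS.2.mvfderiv_η_ξ hV.mdiff,
    sub_zero, zero_smul, add_zero, map_zero, sub_self]

theorem IsST.nijenhuis_coneLift_zero (hS : S.IsST) (hV : SmoothField V x.2)
    (hW : SmoothField W x.2) :
    S.cone.nijenhuis (coneLift (fun _ => 0) V) (coneLift (fun _ => 0) W) x = 0 := by
  have hφV := hV.endo S.smooth_φ
  have hφW := hW.endo S.smooth_φ
  have hηV := (S.contMDiffAt_η hV).neg
  have hηW := (S.contMDiffAt_η hW).neg
  have cone_J : S.cone.J = S.coneJ := rfl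
  simp only [AlmostHermitian.nijenhuis, cone_J]
  rw [coneJ_coneLift_zero_left, coneJ_coneLift_zero_left, mlieBracket_coneLift hηV hηW hφV hφW,
    mlieBracket_coneLift contMDiffAt_const contMDiffAt_const hV hW,
    mlieBracket_coneLift hηV contMDiffAt_const hφV hW,
    mlieBracket_coneLift contMDiffAt_const hηW hV hφW, coneJ_coneVec, coneJ_coneVec, ← map_sub,
    ← map_sub, ← map_sub, ← map_zero (coneVec I x)]
  congr 1
  refine Prod.ext ?_ ?_
  · have dη_φV_W := S.dη_apply hφV.mdiff hW.mdiff
    have dη_V_φW := S.dη_apply hV.mdiff hφW.mdiff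
    rw [mvfderiv_η_φ, zero_apply, hS.dη_φ_left] at dη_φV_W
    rw [mvfderiv_η_φ, zero_apply] at dη_V_φW
    simp only [mvfderiv_fun_neg, mvfderiv_const, zero_apply, neg_apply, Prod.fst_sub, Prod.fst_zero]
    linear_combination (x.1 : ℝ) * dη_φV_W + (x.1 : ℝ) * dη_V_φW
  · have hnormal := hS.1 x.2 V W hV.mdiff hW.mdiff
    rw [S.dη_apply hV.mdiff hW.mdiff, φ_φ_eq] at hnormal
    simp only [mvfderiv_fun_neg, mvfderiv_const, zero_apply, neg_apply, Prod.snd_sub, Prod.snd_zero]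
    rw [← hnormal]
    module

theorem IsST.nijenhuis_coneLift_const (hS : S.IsST) (hV : SmoothField V x.2)
    (hW : SmoothField W x.2) (a b : ℝ) :
    S.cone.nijenhuis (coneLift (fun _ => a) V) (coneLift (fun _ => b) W) x = 0 := by
  have hE := (smoothField_coneEuler (I := I) x).mdiff
  have hcE : ∀ c : ℝ, MDiffField ((fun _ => c) • coneEuler I N) x := fun c =>
    SmoothField.mdiff (contMDiffAt_const.smul_section (smoothField_coneEuler x))
  have lift_mdiff : ∀ {U : Π q : N, TangentSpace I q}, SmoothField U x.2 →
      MDiffField (coneLift (fun _ => 0) U) x := fun hU =>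
    (smoothField_coneLift contMDiffAt_const hU).mdiff
  have left := fun Y => S.cone.tensorialAt_nijenhuis_left Y x
  have right := fun X => S.cone.tensorialAt_nijenhuis_right X x
  rw [coneLift_const_eq a V, coneLift_const_eq b W, (left _).add (hcE a) (lift_mdiff hV),
    (left _).smul mdifferentiableAt_const hE, (right _).add (hcE b) (lift_mdiff hW),
    (right _).add (hcE b) (lift_mdiff hW), (right _).smul mdifferentiableAt_const hE,
    (right _).smul mdifferentiableAt_const hE, AlmostHermitian.nijenhuis_self,
    hS.nijenhuis_coneEuler hW, S.cone.nijenhuis_swap (coneEuler I N), hS.nijenhuis_coneEuler hV,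
    hS.nijenhuis_coneLift_zero hV hW]
  simp only [smul_zero, neg_zero, add_zero]

theorem IsST.isIntegrable_cone (hS : S.IsST) : S.cone.IsIntegrable := by
  intro x X Y hX hY
  obtain ⟨a, v, hXv⟩ := exists_eq_coneVec_mul x (X x)
  obtain ⟨b, w, hYw⟩ := exists_eq_coneVec_mul x (Y x)
  obtain ⟨V, hV, rfl⟩ := exists_smoothField_eq v
  obtain ⟨W, hW, rfl⟩ := exists_smoothField_eq w
  exact (TensorialAt.pointwise₂ (Φ := fun X Y => S.cone.nijenhuis X Y x)
    (fun Y _ => S.cone.tensorialAt_nijenhuis_left Y x)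
    (fun X _ => S.cone.tensorialAt_nijenhuis_right X x) hX
    (smoothField_coneLift contMDiffAt_const hV).mdiff hY
    (smoothField_coneLift contMDiffAt_const hW).mdiff hXv hYw).trans
    (hS.nijenhuis_coneLift_const hV hW a b)

end AlmostContactMetric

end ConeIntegrability

section FormOperations

variable {E : Type*} [NormedAddCommGroup E] [NormedSpace ℝ E]
  {H : Type*} [TopologicalSpace H] {I : ModelWithCorners ℝ E H}
  {M : Type*} [TopologicalSpace M] [ChartedSpace H M] {k : ℕ} {x : M}

theorem extD_smul (r : ℝ) (α : DiffForm I M k) (x : M) :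
    extD (fun y => r • α y) x = r • extD α x :=
  congrArg (fun β : E [⋀^Fin (k + 1)]→L[ℝ] ℝ =>
      β.compContinuousLinearMap (mfderiv I 𝓘(ℝ, E) (extChartAt I x) x : E →L[ℝ] E))
    (extDerivWithin_fun_smul r (chartForm α x) (I.uniqueDiffOn _ (mem_range_self (chartAt H x x))))

variable [IsManifold I ∞ M]

theorem SmoothFormAt.wedge {α : Π y : M, TangentSpace I y →L[ℝ] ℝ} {β : DiffForm I M k}
    (hα : SmoothFormAt (fun y => oneForm (α y)) x) (hβ : SmoothFormAt β x) :
    SmoothFormAt (fun y => wedge (α y) (β y)) x := fun V hV => by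
  simp only [wedge_apply]
  exact contMDiffAt_finsetSum fun i _ => contMDiffAt_const.mul
    ((hα (fun _ => V i) fun _ => hV i).mul (hβ _ fun j => hV (i.succAbove j)))

theorem SmoothFormAt.sub_smul {α β : DiffForm I M k} (hα : SmoothFormAt α x)
    (hβ : SmoothFormAt β x) (r : ℝ) : SmoothFormAt (fun y => α y - r • β y) x :=
  fun V hV => (hα V hV).sub (contMDiffAt_const.mul (hβ V hV))

variable [FiniteDimensional ℝ E]

theorem SmoothFormAt.extD_apply_of_contraction_eq_zero {α : DiffForm I M (k + 1)}
    (hα : SmoothFormAt α x) {V : Fin (k + 2) → Π y : M, TangentSpace I y}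
    (hV : ∀ i, MDiffField (V i) x)
    (hcontract : ∀ y (v : Fin (k + 1) → TangentSpace I y) i, v i = V 0 y → α y v = 0)
    (hcomm : ∀ j : Fin (k + 1), VectorField.mlieBracket I (V 0) (V j.succ) x = 0) :
    TorsionGeometry.extD α x (fun i => V i x)
      = mvfderiv I (fun y => α y fun i => V i.succ y) x (V 0 x) := by
  have derivatives_eq_zero : ∀ i : Fin (k + 2), i ≠ 0 →
      mvfderiv I (fun y => α y (i.removeNth fun j => V j y)) x = 0 := fun i hi => by
    have hzero : (fun y => α y (i.removeNth fun j => V j y)) = fun _ => 0 := funext fun y =>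
      hcontract y _ 0 (by rw [Fin.removeNth_apply, Fin.succAbove_ne_zero_zero hi])
    rw [hzero, mvfderiv_const]
  have brackets_eq_zero : ∀ i j : Fin (k + 1), i ≤ j →
      α x (Matrix.vecCons (VectorField.mlieBracket I (V i.castSucc) (V j.succ) x)
        (j.removeNth <| i.castSucc.removeNth fun l => V l x)) = 0 := fun i j hij => by
    rcases eq_or_ne i 0 with rfl | hi
    · exact (α x).map_coord_zero 0 (hcomm j)
    · cases k with
      | zero => exact absurd (Fin.fin_one_eq_zero i) hi
      | succ k =>
        have hslot : i.castSucc.succAbove (j.succAbove 0) = 0 := by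
          rw [Fin.succAbove_ne_zero_zero fun hj => hi (Fin.le_zero_iff.1 (hj ▸ hij)),
            Fin.succAbove_ne_zero_zero (Fin.castSucc_ne_zero_iff.2 hi)]
        exact hcontract x _ 1 (congrArg (fun l => V l x) hslot)
  rw [hα.extD_apply hV, Finset.sum_eq_single 0, Finset.sum_eq_zero fun i _ =>
    Finset.sum_eq_zero fun j hj => by rw [brackets_eq_zero i j (Finset.mem_Ici.1 hj), mul_zero],
    sub_zero, Fin.val_zero, pow_zero, one_mul]
  · rfl
  · exact fun i _ hi => by rw [derivatives_eq_zero i hi, zero_apply, mul_zero]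
  · exact fun h => absurd (Finset.mem_univ 0) h

end FormOperations

section ConeForms

variable {E : Type*} [NormedAddCommGroup E] [NormedSpace ℝ E]
  {H : Type*} [TopologicalSpace H] {I : ModelWithCorners ℝ E H}
  {N : Type*} [TopologicalSpace N] [ChartedSpace H N] [IsManifold I ∞ N]

namespace AlmostContactMetric

variable (S : AlmostContactMetric I N)

/-- The `3`-form `η ∧ (dη - 2F) + d^φ F` on `N`; the torsion of the cone is `r²` times its
pullback. -/
def baseTorsion : DiffForm I N 3 := fun x =>
  wedge (S.η x) (S.dη x - (2 : ℝ) • S.F x) + S.dφF x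

theorem baseTorsion_apply (x : N) (u v w : TangentSpace I x) :
    S.baseTorsion x ![u, v, w] = S.η x u * (S.dη x ![v, w] - 2 * S.F x ![v, w])
        - S.η x v * (S.dη x ![u, w] - 2 * S.F x ![u, w])
        + S.η x w * (S.dη x ![u, v] - 2 * S.F x ![u, v])
        + extD S.F x ![S.φ x u, S.φ x v, S.φ x w] :=
  congrArg₂ (· + ·) (wedge_apply_three _ _ u v w)
    (congrArg (extD S.F x) (FinVec.etaExpand_eq fun i => S.φ x (![u, v, w] i)).symm)

theorem coneTorsion_apply (x : Cone N) (y : Fin 3 → TangentSpace (𝓘(ℝ, ℝ).prod I) x) :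
    S.coneTorsion x y = (x.1 : ℝ) ^ 2 * S.baseTorsion x.2 fun i => dπ I x (y i) := rfl

theorem coneTorsion_coneVec (x : Cone N) (a b c : ℝ) (u v w : TangentSpace I x.2) :
    S.coneTorsion x ![coneVec I x (a, u), coneVec I x (b, v), coneVec I x (c, w)]
      = (x.1 : ℝ) ^ 2 * S.baseTorsion x.2 ![u, v, w] := by
  have dπ_coneVec_triple : (fun i => dπ I x
      (![coneVec I x (a, u), coneVec I x (b, v), coneVec I x (c, w)] i)) = ![u, v, w] := by
    ext i
    fin_cases i <;> exact dπ_coneVec ..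
  rw [coneTorsion_apply, dπ_coneVec_triple]

theorem coneTorsion_eq_zero_of_eq_coneEuler (x : Cone N)
    (y : Fin 3 → TangentSpace (𝓘(ℝ, ℝ).prod I) x) (i : Fin 3) (hi : y i = coneEuler I N x) :
    S.coneTorsion x y = 0 := by
  have hπ : dπ I x (y i) = 0 := (congrArg (dπ I x) hi).trans (dπ_coneVec ..)
  rw [coneTorsion_apply, (S.baseTorsion x.2).map_coord_zero i hπ, mul_zero]

theorem F_φ_add_smul_ξ (x : N) (a b : ℝ) (u v : TangentSpace I x) :
    S.F x ![S.φ x u + a • S.ξ x, S.φ x v + b • S.ξ x] = S.F x ![u, v] := by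
  simp only [ContinuousAlternatingMap.vecCons_add, ContinuousAlternatingMap.vecCons_smul,
    map_snd_add, map_snd_smul, S.F_ξ_left, S.F_ξ_right, S.F_φ_φ, smul_zero, add_zero]

variable [FiniteDimensional ℝ E]

theorem cone_fundForm_coneVec (x : Cone N) (a b : ℝ) (v w : TangentSpace I x.2) :
    S.cone.fundForm x ![coneVec I x ((x.1 : ℝ) * a, v), coneVec I x ((x.1 : ℝ) * b, w)]
      = (x.1 : ℝ) ^ 2 * (a * S.η x.2 w - b * S.η x.2 v + S.F x.2 ![v, w]) := by
  have fundForm_eq : S.cone.fundForm x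
        ![coneVec I x ((x.1 : ℝ) * a, v), coneVec I x ((x.1 : ℝ) * b, w)]
      = coneInner I x (S.g.inner x.2) (S.coneJ x (coneVec I x ((x.1 : ℝ) * a, v)))
        (coneVec I x ((x.1 : ℝ) * b, w)) := rfl
  have inner_ξ : S.g.inner x.2 (S.ξ x.2) w = S.η x.2 w := rfl
  rw [fundForm_eq, S.coneJ_coneVec, coneInner_apply, dr_coneVec, dr_coneVec, dπ_coneVec,
    dπ_coneVec, map_add, map_smul, add_apply, smul_apply, inner_ξ, smul_eq_mul, S.F_apply]
  ring

theorem cone_fundForm (x : Cone N) : S.cone.fundForm x = S.coneForm x := by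
  ext u
  have coneForm_eq : S.coneForm x u
      = (x.1 : ℝ) * wedge (dr I x) (oneForm ((S.η x.2).comp (dπ I x))) u
        + (x.1 : ℝ) ^ 2 * S.F x.2 fun i => dπ I x (u i) := rfl
  rw [coneForm_eq, ← FinVec.etaExpand_eq u, ← FinVec.etaExpand_eq fun i => dπ I x _]
  change S.cone.fundForm x ![u 0, u 1]
    = (x.1 : ℝ) * wedge (dr I x) (oneForm ((S.η x.2).comp (dπ I x))) ![u 0, u 1]
      + (x.1 : ℝ) ^ 2 * S.F x.2 ![dπ I x (u 0), dπ I x (u 1)]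
  obtain ⟨a, v, hav⟩ := exists_eq_coneVec_mul x (u 0)
  obtain ⟨b, w, hbw⟩ := exists_eq_coneVec_mul x (u 1)
  rw [hav, hbw, S.cone_fundForm_coneVec, wedge_oneForm_apply, dr_coneVec, dr_coneVec,
    ContinuousLinearMap.comp_apply, ContinuousLinearMap.comp_apply, dπ_coneVec, dπ_coneVec]
  ring

section ConstantLifts

variable {x : Cone N} {U V W : Π q : N, TangentSpace I q}

theorem mvfderiv_cone_fundForm_coneLift (a b : ℝ) (hU : SmoothField U x.2)
    (hV : SmoothField V x.2) (c : ℝ) (w : TangentSpace I x.2) :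
    mvfderiv (𝓘(ℝ, ℝ).prod I)
        (fun y => S.cone.fundForm y ![coneLift (fun _ => a) U y, coneLift (fun _ => b) V y]) x
        (coneVec I x ((x.1 : ℝ) * c, w))
      = (x.1 : ℝ) ^ 2 * (a * mvfderiv I (fun q => S.η q (V q)) x.2 w
          - b * mvfderiv I (fun q => S.η q (U q)) x.2 w
          + mvfderiv I (fun q => S.F q ![U q, V q]) x.2 w
          + 2 * c * (a * S.η x.2 (V x.2) - b * S.η x.2 (U x.2) + S.F x.2 ![U x.2, V x.2])) := by
  have fundForm_eq : (fun y => S.cone.fundForm y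
        ![coneLift (fun _ => a) U y, coneLift (fun _ => b) V y])
      = fun y : Cone N => (y.1 : ℝ) ^ 2 * (a * S.η y.2 (V y.2) - b * S.η y.2 (U y.2)
        + S.F y.2 ![U y.2, V y.2]) :=
    funext fun y => S.cone_fundForm_coneVec y a b (U y.2) (V y.2)
  have hηU := (S.contMDiffAt_η hU).mdifferentiableAt (by simp)
  have hηV := (S.contMDiffAt_η hV).mdifferentiableAt (by simp)
  have hbU : MDifferentiableAt I 𝓘(ℝ, ℝ) (fun q => b * S.η q (U q)) x.2 :=
    mdifferentiableAt_const.mul hηU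
  have haV : MDifferentiableAt I 𝓘(ℝ, ℝ) (fun q => a * S.η q (V q)) x.2 :=
    mdifferentiableAt_const.mul hηV
  have haV_sub_bU : MDifferentiableAt I 𝓘(ℝ, ℝ)
      (fun q => a * S.η q (V q) - b * S.η q (U q)) x.2 := haV.sub hbU
  have hF : MDifferentiableAt I 𝓘(ℝ, ℝ) (fun q => S.F q ![U q, V q]) x.2 :=
    mdifferentiableAt_inner S.g (hU.mdiff.endo S.smooth_φ) hV.mdiff
  have hsum : MDifferentiableAt I 𝓘(ℝ, ℝ)
      (fun q => a * S.η q (V q) - b * S.η q (U q) + S.F q ![U q, V q]) x.2 := haV_sub_bU.add hF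
  rw [fundForm_eq, mvfderiv_radius_sq_mul hsum, dr_coneVec, dπ_coneVec,
    mvfderiv_fun_add haV_sub_bU hF, mvfderiv_fun_sub haV hbU,
    mvfderiv_fun_mul mdifferentiableAt_const hηV, mvfderiv_fun_mul mdifferentiableAt_const hηU,
    mvfderiv_const, mvfderiv_const]
  simp only [add_apply, sub_apply, smul_apply, smul_zero, add_zero, smul_eq_mul]
  ring

theorem cone_fundForm_mlieBracket_coneLift (a b c : ℝ) (hU : SmoothField U x.2)
    (hV : SmoothField V x.2) (w : TangentSpace I x.2) :
    S.cone.fundForm x ![VectorField.mlieBracket (𝓘(ℝ, ℝ).prod I) (coneLift (fun _ => a) U)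
        (coneLift (fun _ => b) V) x, coneVec I x ((x.1 : ℝ) * c, w)]
      = (x.1 : ℝ) ^ 2 * (-c * S.η x.2 (VectorField.mlieBracket I U V x.2)
        + S.F x.2 ![VectorField.mlieBracket I U V x.2, w]) := by
  rw [mlieBracket_coneLift contMDiffAt_const contMDiffAt_const hU hV, S.cone_fundForm_coneVec,
    mvfderiv_const, mvfderiv_const]
  simp only [zero_apply]
  ring

end ConstantLifts

theorem extD_cone_fundForm_coneVec (x : Cone N) (a b c : ℝ) (u v w : TangentSpace I x.2) :
    extD S.cone.fundForm x ![coneVec I x ((x.1 : ℝ) * a, u), coneVec I x ((x.1 : ℝ) * b, v),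
        coneVec I x ((x.1 : ℝ) * c, w)]
      = (x.1 : ℝ) ^ 2 * (extD S.F x.2 ![u, v, w]
        - a * (S.dη x.2 ![v, w] - 2 * S.F x.2 ![v, w])
        + b * (S.dη x.2 ![u, w] - 2 * S.F x.2 ![u, w])
        - c * (S.dη x.2 ![u, v] - 2 * S.F x.2 ![u, v])) := by
  obtain ⟨U, hU, rfl⟩ := exists_smoothField_eq u
  obtain ⟨V, hV, rfl⟩ := exists_smoothField_eq v
  obtain ⟨W, hW, rfl⟩ := exists_smoothField_eq w
  have hlift : ∀ (t : ℝ) {P : Π q : N, TangentSpace I q}, SmoothField P x.2 →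
      MDiffField (coneLift (fun _ => t) P) x :=
    fun _ _ hP => (smoothField_coneLift contMDiffAt_const hP).mdiff
  refine ((S.cone.smoothFormAt_fundForm x).extD_triple (hlift a hU) (hlift b hV)
    (hlift c hW)).trans ?_
  rw [(S.smoothFormAt_F x.2).extD_triple hU.mdiff hV.mdiff hW.mdiff, S.dη_apply hV.mdiff hW.mdiff,
    S.dη_apply hU.mdiff hW.mdiff, S.dη_apply hU.mdiff hV.mdiff]
  simp only [coneLift.eq_1 _ _ x]
  rw [S.mvfderiv_cone_fundForm_coneLift b c hV hW, S.mvfderiv_cone_fundForm_coneLift a c hU hW,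
    S.mvfderiv_cone_fundForm_coneLift a b hU hV, S.cone_fundForm_mlieBracket_coneLift a b c hU hV,
    S.cone_fundForm_mlieBracket_coneLift a c b hU hW,
    S.cone_fundForm_mlieBracket_coneLift b c a hV hW]
  ring

theorem smoothFormAt_baseTorsion (x : N) : SmoothFormAt S.baseTorsion x := fun V hV =>
  ((S.smoothFormAt_η x).wedge ((SmoothFormAt.extD S.smoothFormAt_η).sub_smul
    (S.smoothFormAt_F x) 2) V hV).add
    (SmoothFormAt.extD S.smoothFormAt_F (fun i y => S.φ y (V i y)) fun i => (hV i).endo S.smooth_φ)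

variable {S}

theorem IsST.dη_φ_add_smul_ξ (hS : S.IsST) (x : N) (a b : ℝ) (u v : TangentSpace I x) :
    S.dη x ![S.φ x u + a • S.ξ x, S.φ x v + b • S.ξ x] = S.dη x ![u, v] := by
  simp only [ContinuousAlternatingMap.vecCons_add, ContinuousAlternatingMap.vecCons_smul,
    map_snd_add, map_snd_smul, hS.2.dη_ξ_left, map_swap_fst_snd _ (S.ξ x) (S.φ x u),
    hS.1.dη_φ_φ, neg_zero, smul_zero, add_zero]

theorem IsST.cone_bismutForm (hS : S.IsST) : S.cone.bismutForm = S.coneTorsion := by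
  funext x
  ext y
  have cone_J : S.cone.J = S.coneJ := rfl
  rw [← FinVec.etaExpand_eq y]
  change S.cone.bismutForm x ![y 0, y 1, y 2] = S.coneTorsion x ![y 0, y 1, y 2]
  obtain ⟨a, u, hau⟩ := exists_eq_coneVec_mul x (y 0)
  obtain ⟨b, v, hbv⟩ := exists_eq_coneVec_mul x (y 1)
  obtain ⟨c, w, hcw⟩ := exists_eq_coneVec_mul x (y 2)
  rw [hau, hbv, hcw, S.coneTorsion_coneVec, S.baseTorsion_apply, AlmostHermitian.bismutForm_apply,
    cone_J, S.coneJ_coneVec, S.coneJ_coneVec, S.coneJ_coneVec, S.extD_cone_fundForm_coneVec,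
    map_add_smul_of_forall_map_eq_zero (hS.dF_ξ_left x.2), hS.dη_φ_add_smul_ξ,
    hS.dη_φ_add_smul_ξ, hS.dη_φ_add_smul_ξ, S.F_φ_add_smul_ξ, S.F_φ_add_smul_ξ, S.F_φ_add_smul_ξ]
  ring

theorem IsST.extD_coneTorsion_coneEuler (hS : S.IsST) (x : Cone N)
    (u : Fin 3 → TangentSpace I x.2) :
    extD S.coneTorsion x (Matrix.vecCons (coneEuler I N x) fun i => coneVec I x (0, u i))
      = 2 * (x.1 : ℝ) ^ 2 * S.baseTorsion x.2 u := by
  choose U hU hUu using fun i => exists_smoothField_eq (u i)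
  obtain rfl : (fun i => U i x.2) = u := funext hUu
  have hlift := fun i => smoothField_coneLift (f := fun _ => 0) contMDiffAt_const (hU i)
  have smoothFormAt_coneTorsion : SmoothFormAt S.coneTorsion x :=
    hS.cone_bismutForm ▸ S.cone.smoothFormAt_bismutForm x
  have coneTorsion_lift : (fun y => S.coneTorsion y fun i => coneLift (fun _ => 0) (U i) y)
      = fun y : Cone N => (y.1 : ℝ) ^ 2 * S.baseTorsion y.2 fun i => U i y.2 :=
    funext fun y => congrArg (fun v => (y.1 : ℝ) ^ 2 * S.baseTorsion y.2 v)
      (funext fun i => dπ_coneVec ..)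
  have hcartan := smoothFormAt_coneTorsion.extD_apply_of_contraction_eq_zero
    (V := Matrix.vecCons (coneEuler I N) fun i => coneLift (fun _ => 0) (U i))
    (Fin.cases (smoothField_coneEuler x).mdiff fun i => (hlift i).mdiff)
    S.coneTorsion_eq_zero_of_eq_coneEuler
    fun i => mlieBracket_coneEuler_coneLift contMDiffAt_const (hU i)
  refine (congrArg (extD S.coneTorsion x) (funext (Fin.cases rfl fun i =>
    congrArg (fun t => coneVec I x (t, U i x.2)) (mul_zero _).symm))).trans
    (hcartan.trans ?_)
  refine (congrArg (fun f => mvfderiv _ f x (coneEuler I N x)) coneTorsion_lift).trans ?_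
  rw [mvfderiv_radius_sq_mul ((S.smoothFormAt_baseTorsion x.2).mdifferentiableAt
    fun i => (hU i).mdiff), coneEuler, coneLift, dr_coneVec, dπ_coneVec, Pi.zero_apply, map_zero]
  ring

theorem IsST.forall_extD_coneTorsion_eq_zero_iff (hS : S.IsST) :
    (∀ x, extD S.coneTorsion x = 0) ↔ ∀ x, S.baseTorsion x = 0 := by
  refine ⟨fun h q => ?_, fun h x => ?_⟩
  · ext u
    have hEuler := hS.extD_coneTorsion_coneEuler (⟨1, mem_Ioi.2 one_pos⟩, q) u
    rw [h] at hEuler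
    simpa using hEuler.symm
  · have coneTorsion_eq : S.coneTorsion = fun y => (0 : ℝ) • S.coneTorsion y := by
      funext y
      ext v
      rw [coneTorsion_apply, h, zero_smul]
      exact mul_zero _
    rw [coneTorsion_eq, extD_smul, zero_smul]

theorem IsSasaki.extD_F (hS : S.IsSasaki) (x : N) : extD S.F x = 0 := by
  have hF : S.F = fun y => (2 : ℝ)⁻¹ • S.dη y := funext fun y => by
    rw [hS.2, smul_smul, inv_mul_cancel₀ two_ne_zero, one_smul]
  have hdη : extD S.dη x = 0 := extD_extD S.smoothFormAt_η x
  rw [hF, extD_smul, hdη, smul_zero]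

theorem IsST.isSasaki_iff_baseTorsion_eq_zero (hS : S.IsST) :
    S.IsSasaki ↔ ∀ x, S.baseTorsion x = 0 := by
  refine ⟨fun hSasaki x => ?_, fun h => ⟨hS.1, fun x => ?_⟩⟩
  · have hdφF : S.dφF x = 0 := by
      rw [dφF, hSasaki.extD_F]
      rfl
    have hwedge : wedge (S.η x) (0 : TangentSpace I x [⋀^Fin 2]→L[ℝ] ℝ) = 0 := by
      ext v
      simp [wedge_apply]
    rw [baseTorsion, hSasaki.2, sub_self, hwedge, hdφF, add_zero]
  · ext v
    have hξ := S.baseTorsion_apply x (S.ξ x) (v 0) (v 1)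
    rw [h, S.η_ξ, hS.2.dη_ξ_left, hS.2.dη_ξ_left, S.F_ξ_left, S.F_ξ_left, S.φ_ξ,
      (extD S.F x).map_coord_zero 0 rfl, mul_zero, sub_zero, mul_zero, mul_zero, sub_zero,
      add_zero, add_zero, one_mul] at hξ
    rw [← FinVec.etaExpand_eq v]
    exact sub_eq_zero.1 hξ.symm

end AlmostContactMetric

end ConeForms

end TorsionGeometry

end

theorem mainTheorem7_general {E : Type*} [NormedAddCommGroup E] [NormedSpace ℝ E]
    [FiniteDimensional ℝ E] {H : Type*} [TopologicalSpace H] (I : ModelWithCorners ℝ E H)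
    {N : Type*} [TopologicalSpace N] [ChartedSpace H N] [IsManifold I ∞ N]
    (S : AlmostContactMetric I N) (hS : S.IsST) :
    (∀ x, S.cone.fundForm x = S.coneForm x) ∧
    S.cone.IsKTWithTorsion S.coneTorsion ∧
    (S.cone.IsSKT ↔ S.IsSasaki) := by
  refine ⟨S.cone_fundForm, ?_, ?_⟩
  · exact AlmostHermitian.isKTWithTorsion_iff.2 ⟨hS.isIntegrable_cone, hS.cone_bismutForm.symm⟩
  · rw [AlmostHermitian.isSKT_iff, and_iff_right hS.isIntegrable_cone, hS.cone_bismutForm,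
      hS.forall_extD_coneTorsion_eq_zero_iff, hS.isSasaki_iff_baseTorsion_eq_zero]

theorem mainTheorem7 {E : Type*} [NormedAddCommGroup E] [NormedSpace ℝ E] [FiniteDimensional ℝ E]
    {H : Type*} [TopologicalSpace H] (I : ModelWithCorners ℝ E H) [I.Boundaryless]
    {N : Type*} [TopologicalSpace N] [ChartedSpace H N] [IsManifold I ∞ N]
    [T2Space N] [SecondCountableTopology N] (hodd : Odd (Module.finrank ℝ E))
    (S : AlmostContactMetric I N) (hS : S.IsST) :
    (∀ x, S.cone.fundForm x = S.coneForm x) ∧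
    S.cone.IsKTWithTorsion S.coneTorsion ∧
    (S.cone.IsSKT ↔ S.IsSasaki) := mainTheorem7_general I S hS
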